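/- Let $n\ge 1$ agents and a set $\mathcal M$ of $m$ items be given. Each agent $i$ has a valuation $V_i:2^{\mathcal M}\to\mathbb Q_{\ge 0}$ that is non-negative, monotone, and submodular, i.e. $V_i(S)+V_i(T)\ge V_i(S\cup T)+V_i(S\cap T)$ for all $S,T\subseteq\mathcal M$. The maxmin value of agent $i$ is $$\mathsf{MMS}_i=\max_{(P_1,\dots,P_n)}\ \min_{1\le j\le n}V_i(P_j),$$ where the maximum is over all partitions of $\mathcal M$ into $n$ pairwise disjoint, possibly empty, sets. The valuations are accessible only through value queries: a query for an agent $i$ and a set $S\subseteq\mathcal M$ returns $V_i(S)$. **Theorem.** There are a single algorithm (a deterministic random access machine with value queries, whose running time counts the bits of all numbers it handles) and a polynomial $p$ such that the following holds for all $n\ge 1$, all $m$ and all such valuations. If every value $V_i(S)$ has at most $B$ bits (numerator and denominator of the reduced fraction together), then the algorithm, which is given only $n$, $m$ and the value-query oracles (neither $B$ nor the values $\mathsf{MMS}_i$), halts after time at most $p(n+m+B)$. Its output is a $1/3$-MMS allocation, that is, a partition of $\mathcal M$ into pairwise disjoint sets $A_1,\dots,A_n$ with $V_i(A_i)\ge \tfrac13\,\mathsf{MMS}_i$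 for every agent $i$. -/

import Mathlib

namespace FairAllocation

/-! ### The fair allocation problem: `n` agents `Fin n`, `m` items `Fin m` -/

/-- `A` splits the item set into the pairwise disjoint (possibly empty) bundles
`A 0, …, A (r - 1)` whose union is the set of all items. -/
structure IsAllocation {m r : ℕ} (A : Fin r → Finset (Fin m)) : Prop where
  disjoint : ∀ i j, i ≠ j → Disjoint (A i) (A j)
  union : Finset.univ.biUnion A = Finset.univ

open Classical in
/-- The finite set of all partitionings of the `m` items into `r` bundles. -/
noncomputable def partitionings (m r : ℕ) : Finset (Fin r → Finset (Fin m)) :=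
  Finset.univ.filter IsAllocation

theorem partitionings_nonempty (m r : ℕ) [NeZero r] : (partitionings m r).Nonempty := by
  classical
  refine ⟨fun i => if i = 0 then Finset.univ else ∅, ?_⟩
  simp only [partitionings, Finset.mem_filter, Finset.mem_univ, true_and]
  constructor
  · intro i j hij
    by_cases hi : i = 0
    · have hj : j ≠ 0 := fun h => hij (hi.trans h.symm)
      simp [hj]
    · simp [hi]
  · ext x
    simp only [Finset.mem_biUnion, Finset.mem_univ, true_and, iff_true]
    exact ⟨0, by simp⟩

/-- The maxmin value: the maximum over all partitionings of the items into `r` bundles of the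
minimum over the bundles of their value. -/
noncomputable def mms {m : ℕ} (r : ℕ) [NeZero r] (f : Finset (Fin m) → ℚ) : ℚ :=
  (partitionings m r).sup' (partitionings_nonempty m r)
    (fun P => Finset.univ.inf' Finset.univ_nonempty (fun j => f (P j)))

/-- An `α`-MMS allocation for the valuations `V`. -/
structure IsMMSAllocation {n m : ℕ} [NeZero n] (α : ℚ) (V : Fin n → Finset (Fin m) → ℚ)
    (A : Fin n → Finset (Fin m)) : Prop where
  isAllocation : IsAllocation A
  le_value : ∀ i, α * mms n (V i) ≤ V i (A i)

/-- Non-negative monotone submodular set functions. -/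
structure IsSubmodularValuation {m : ℕ} (f : Finset (Fin m) → ℚ) : Prop where
  nonneg : ∀ S, 0 ≤ f S
  mono : Monotone f
  submodular : ∀ S T, f (S ∪ T) + f (S ∩ T) ≤ f S + f T

/-! ### Random access machines with value queries and logarithmic (bit) cost

The memory consists of arrays of natural numbers (used for indices, counters and sets) and arrays
of rational numbers (used for values). Arrays are numbered, unbounded, and addressed indirectly;
a program mentions only finitely many of them. Programs are structured (`while` programs), and
the evaluation of an expression is charged, at each of its nodes, one unit plus the number of bits
of the number computed there. -/

/-- The number of bits of a rational number, written as a reduced fraction. -/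
def ratBits (q : ℚ) : ℕ := q.num.natAbs.size + q.den.size

/-- `idx a k` and `val a k` are the contents of the `k`-th cell of the `a`-th array. -/
structure Memory where
  idx : ℕ → ℕ → ℕ
  val : ℕ → ℕ → ℚ

/-- Expressions for natural numbers; `sub` is truncated subtraction. -/
inductive IdxExpr where
  | const (k : ℕ)
  | load (a : ℕ) (i : IdxExpr)
  | add (x y : IdxExpr)
  | sub (x y : IdxExpr)
  | mul (x y : IdxExpr)

namespace IdxExpr

def eval (s : Memory) : IdxExpr → ℕ
  | const k => k
  | load a i => s.idx a (i.eval s)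
  | add x y => x.eval s + y.eval s
  | sub x y => x.eval s - y.eval s
  | mul x y => x.eval s * y.eval s

def cost (s : Memory) : IdxExpr → ℕ
  | const k => 1 + k.size
  | load a i => i.cost s + 1 + (s.idx a (i.eval s)).size
  | add x y => x.cost s + y.cost s + 1 + (x.eval s + y.eval s).size
  | sub x y => x.cost s + y.cost s + 1 + (x.eval s - y.eval s).size
  | mul x y => x.cost s + y.cost s + 1 + (x.eval s * y.eval s).size

end IdxExpr

/-- Expressions for rational numbers; division by `0` gives `0`. -/
inductive ValExpr where
  | const (q : ℚ)
  | load (a : ℕ) (i : IdxExpr)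
  | ofIdx (i : IdxExpr)
  | add (x y : ValExpr)
  | sub (x y : ValExpr)
  | mul (x y : ValExpr)
  | div (x y : ValExpr)

namespace ValExpr

def eval (s : Memory) : ValExpr → ℚ
  | const q => q
  | load a i => s.val a (i.eval s)
  | ofIdx i => (i.eval s : ℚ)
  | add x y => x.eval s + y.eval s
  | sub x y => x.eval s - y.eval s
  | mul x y => x.eval s * y.eval s
  | div x y => x.eval s / y.eval s

def cost (s : Memory) : ValExpr → ℕ
  | const q => 1 + ratBits q
  | load a i => i.cost s + 1 + ratBits (s.val a (i.eval s))
  | ofIdx i => i.cost s + 1 + ratBits (i.eval s : ℚ)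
  | add x y => x.cost s + y.cost s + 1 + ratBits (x.eval s + y.eval s)
  | sub x y => x.cost s + y.cost s + 1 + ratBits (x.eval s - y.eval s)
  | mul x y => x.cost s + y.cost s + 1 + ratBits (x.eval s * y.eval s)
  | div x y => x.cost s + y.cost s + 1 + ratBits (x.eval s / y.eval s)

end ValExpr

/-- Tests. -/
inductive Test where
  | idxLe (x y : IdxExpr)
  | valLe (x y : ValExpr)
  | not (b : Test)
  | and (b c : Test)

namespace Test

def Holds (s : Memory) : Test → Prop
  | idxLe x y => x.eval s ≤ y.eval s
  | valLe x y => x.eval s ≤ y.eval s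
  | not b => ¬ b.Holds s
  | and b c => b.Holds s ∧ c.Holds s

def cost (s : Memory) : Test → ℕ
  | idxLe x y => x.cost s + y.cost s + 1
  | valLe x y => x.cost s + y.cost s + 1
  | not b => b.cost s + 1
  | and b c => b.cost s + c.cost s + 1

end Test

/-- Programs. The command `query a i k t` asks the value oracle of the agent whose number is `k`
for the value of the set of those items `j` for which the `j`-th cell of the `t`-th index array is
non-zero, and stores the answer in cell `i` of the `a`-th value array. -/
inductive Program where
  | skip
  | setIdx (a : ℕ) (i : IdxExpr) (x : IdxExpr)
  | setVal (a : ℕ) (i : IdxExpr) (x : ValExpr)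
  | query (a : ℕ) (i : IdxExpr) (k : IdxExpr) (t : ℕ)
  | seq (p q : Program)
  | ite (b : Test) (p q : Program)
  | loop (b : Test) (p : Program)

/-- Memory after writing `x` into cell `k` of index array `a`. -/
def Memory.setIdx (s : Memory) (a k x : ℕ) : Memory :=
  { s with idx := Function.update s.idx a (Function.update (s.idx a) k x) }

/-- Memory after writing `x` into cell `k` of value array `a`. -/
def Memory.setVal (s : Memory) (a k : ℕ) (x : ℚ) : Memory :=
  { s with val := Function.update s.val a (Function.update (s.val a) k x) }

/-- The set of items that index array `t` describes. -/
def Memory.itemSet (m : ℕ) (s : Memory) (t : ℕ) : Finset (Fin m) :=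
  Finset.univ.filter (fun j => s.idx t j ≠ 0)

/-- The value oracles of the agents; a query to an agent that does not exist is answered `0`. -/
def valueOracle {n m : ℕ} (V : Fin n → Finset (Fin m) → ℚ) (k : ℕ) (S : Finset (Fin m)) : ℚ :=
  if h : k < n then V ⟨k, h⟩ S else 0

/-- `Runs V p s c s'`: with value oracles for `V`, the program `p`, started in memory `s`, halts
in memory `s'` after time `c`. -/
inductive Runs {n m : ℕ} (V : Fin n → Finset (Fin m) → ℚ) :
    Program → Memory → ℕ → Memory → Prop where
  | skip (s : Memory) : Runs V Program.skip s 1 s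
  | setIdx (s : Memory) (a : ℕ) (i x : IdxExpr) :
      Runs V (Program.setIdx a i x) s (i.cost s + x.cost s + 1)
        (s.setIdx a (i.eval s) (x.eval s))
  | setVal (s : Memory) (a : ℕ) (i : IdxExpr) (x : ValExpr) :
      Runs V (Program.setVal a i x) s (i.cost s + x.cost s + 1)
        (s.setVal a (i.eval s) (x.eval s))
  | query (s : Memory) (a : ℕ) (i k : IdxExpr) (t : ℕ) :
      Runs V (Program.query a i k t) s
        (i.cost s + k.cost s + 1 + ratBits (valueOracle V (k.eval s) (s.itemSet m t)))
        (s.setVal a (i.eval s) (valueOracle V (k.eval s) (s.itemSet m t)))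
  | seq {p q : Program} {s s' s'' : Memory} {c c' : ℕ} :
      Runs V p s c s' → Runs V q s' c' s'' → Runs V (Program.seq p q) s (c + c') s''
  | ite_true {b : Test} {p q : Program} {s s' : Memory} {c : ℕ} :
      b.Holds s → Runs V p s c s' → Runs V (Program.ite b p q) s (b.cost s + 1 + c) s'
  | ite_false {b : Test} {p q : Program} {s s' : Memory} {c : ℕ} :
      ¬ b.Holds s → Runs V q s c s' → Runs V (Program.ite b p q) s (b.cost s + 1 + c) s'
  | loop_true {b : Test} {p : Program} {s s' s'' : Memory} {c c' : ℕ} :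
      b.Holds s → Runs V p s c s' → Runs V (Program.loop b p) s' c' s'' →
      Runs V (Program.loop b p) s (b.cost s + 1 + c + c') s''
  | loop_false {b : Test} {p : Program} {s : Memory} :
      ¬ b.Holds s → Runs V (Program.loop b p) s (b.cost s + 1) s

/-- The input: cells `0` and `1` of index array `0` hold `n` and `m`; all other cells are `0`. -/
def inputMemory (n m : ℕ) : Memory where
  idx a k := if a = 0 then (if k = 0 then n else if k = 1 then m else 0) else 0
  val _ _ := 0

/-- The output: cell `j` of index array `1` holds the number of the agent who receives item `j`.
This is the resulting vector of bundles. -/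
def outputBundles (n m : ℕ) (s : Memory) : Fin n → Finset (Fin m) :=
  fun i => Finset.univ.filter (fun j : Fin m => s.idx 1 j = i)

end FairAllocation

namespace FairAllocation

/-! ### Submodular functions -/

section Submodular

variable {m : ℕ} {f : Finset (Fin m) → ℚ}

/-! The algorithm works with guesses for the maxmin values that start too large and are lowered
cautiously. Let `v` be the `n`-th largest single-item value of an agent (or the value of `∅` if
there are fewer items). Then `v ≤ MMS ≤ v * (m + 1)` (`IsNthValue.le_mms`, `IsNthValue.mms_le`), so
the threshold `T = v * k / (3 * n)` with `k = 3 * n * (m + 1)` is a valid upper bound for MMS to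
start from.

A round tries to give every agent a third of its threshold. Single items worth that much are handed
out and locked, and the agents served leave the competition with threshold `0`. The remaining items
are moved by local search on the potential `∑ min (V i A / T i) (2 / 3)`. Only agents below `1 / 3`
receive items, and each unlocked item is worth less than `1 / 3` to them, so the cap `2 / 3` is
never active for the receiver. Each move gains more than `1 / (3 * m)`, so at most `3 * n * m` moves
are made.

The core is `mms_lt_of_stable`. Let `r` agents have positive thresholds. At least `r` bundles of an
optimal partition of agent `i` avoid the locked items. If `i` is still below a third, submodularity
makes its marginal gains over these bundles add up to at least `r * (MMS - V i A)`. Stability bounds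
them by the capped losses of the other `r - 1` agents, at most `2 / 3` each, plus a total slack of
`1 / 3`. Hence `MMS < T * (1 - 1 / (3 * n))`, and since `v ≤ MMS`, lowering `k` by one keeps `MMS ≤
T` (`le_threshold_pred`). Some `k` drops in every failed round, so there are polynomially many
rounds; in a successful one everybody has `T / 3 ≥ MMS / 3`.

For the running time, each program has a polynomial that bounds its cost as soon as the stored
numbers and the iteration counts of its loops are at most `N`. Stored rationals are only oracle
answers, because thresholds and ratios are recomputed when needed, so bit lengths never accumulate.
A Hoare logic over abstract states (`Triple`, `Rep`) proves correctness and these bounds together.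
-/

theorem IsSubmodularValuation.div_const (hf : IsSubmodularValuation f) {t : ℚ} (ht : 0 ≤ t) :
    IsSubmodularValuation (fun S => f S / t) where
  nonneg S := div_nonneg (hf.nonneg S) ht
  mono S T h := div_le_div_of_nonneg_right (hf.mono h) ht
  submodular S T := by
    rw [← add_div, ← add_div]
    exact div_le_div_of_nonneg_right (hf.submodular S T) ht

/-- Monotonicity is essential: since `f (S ∩ T)` is below and `f (S ∪ T)` above both `f S` and `f
T`, each pattern of active truncations leaves a linear inequality. -/
theorem IsSubmodularValuation.min_const (hf : IsSubmodularValuation f) {c : ℚ} (hc : 0 ≤ c) :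
    IsSubmodularValuation (fun S => min (f S) c) where
  nonneg S := le_min (hf.nonneg S) hc
  mono S T h := min_le_min_right c (hf.mono h)
  submodular S T := by
    have h := hf.submodular S T
    have h₁ : f S ≤ f (S ∪ T) := hf.mono Finset.subset_union_left
    have h₂ : f T ≤ f (S ∪ T) := hf.mono Finset.subset_union_right
    have h₃ : f (S ∩ T) ≤ f S := hf.mono Finset.inter_subset_left
    have h₄ : f (S ∩ T) ≤ f T := hf.mono Finset.inter_subset_right
    simp only [min_def]
    split_ifs <;> linarith

/-- The marginal losses of the elements of a set add up to at most the value of the set. -/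
theorem IsSubmodularValuation.sum_erase_le (hf : IsSubmodularValuation f) (S : Finset (Fin m)) :
    ∑ b ∈ S, (f S - f (S.erase b)) ≤ f S := by
  have key : ∀ U : Finset (Fin m), U ⊆ S → ∑ b ∈ U, (f S - f (S.erase b)) ≤ f U - f ∅ := by
    intro U
    induction U using Finset.induction_on with
    | empty => simp
    | insert b U hb ih =>
      intro hU
      have hbS : b ∈ S := hU (Finset.mem_insert_self _ _)
      have hUS : U ⊆ S := fun x hx => hU (Finset.mem_insert_of_mem hx)
      rw [Finset.sum_insert hb]
      -- The union is `S` and the intersection is `U`, so the loss of `b` from `S` is at most its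
      -- gain over `U`; these gains telescope.
      have h := hf.submodular (insert b U) (S.erase b)
      have h₁ : insert b U ∪ S.erase b = S := by
        ext x
        by_cases hx : x = b
        · simp [hx, hbS]
        · simp only [Finset.mem_union, Finset.mem_insert, Finset.mem_erase, hx]
          exact ⟨fun h => by rcases h with h | h; exacts [hUS (by simpa using h), h.2],
            fun h => Or.inr ⟨hx, h⟩⟩
      have h₂ : insert b U ∩ S.erase b = U := by
        ext x
        by_cases hx : x = b
        · simp [hx, hb]
        · simp only [Finset.mem_inter, Finset.mem_insert, Finset.mem_erase, hx]
          exact ⟨fun h => by simpa using h.1, fun h => ⟨Or.inr h, hx, hUS h⟩⟩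
      rw [h₁, h₂] at h
      linarith [ih hUS]
  linarith [key S subset_rfl, hf.nonneg ∅]

/-- The marginal gains of the elements of `U` add up to at least the marginal gain of `U`. -/
theorem IsSubmodularValuation.le_sum_insert (hf : IsSubmodularValuation f)
    (A U : Finset (Fin m)) : f (A ∪ U) - f A ≤ ∑ b ∈ U, (f (insert b A) - f A) := by
  induction U using Finset.induction_on with
  | empty => simp
  | insert b U hb ih =>
    rw [Finset.sum_insert hb]
    have h := hf.submodular (insert b A) (A ∪ U)
    have h₁ : insert b A ∪ (A ∪ U) = A ∪ insert b U := by
      ext x; simp only [Finset.mem_union, Finset.mem_insert]; tauto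
    have h₂ : f A ≤ f (insert b A ∩ (A ∪ U)) := hf.mono fun x hx => by simp [hx]
    rw [h₁] at h
    linarith

theorem IsSubmodularValuation.insert_le (hf : IsSubmodularValuation f) (A : Finset (Fin m))
    (b : Fin m) : f (insert b A) ≤ f A + f {b} := by
  have h := hf.submodular {b} A
  rw [← Finset.insert_eq] at h
  linarith [hf.nonneg ({b} ∩ A)]

end Submodular

/-! ### Bounds on the maxmin value -/

section Mms

variable {m n : ℕ} [NeZero n] {f : Finset (Fin m) → ℚ}

theorem exists_partition_mms (f : Finset (Fin m) → ℚ) :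
    ∃ P : Fin n → Finset (Fin m), IsAllocation P ∧ ∀ j, mms n f ≤ f (P j) := by
  obtain ⟨P, hP, h⟩ := Finset.exists_mem_eq_sup' (partitionings_nonempty m n)
    (fun P => Finset.univ.inf' Finset.univ_nonempty (fun j => f (P j)))
  refine ⟨P, by simpa [partitionings] using hP, fun j => ?_⟩
  rw [mms, h]
  exact Finset.inf'_le _ (Finset.mem_univ j)

theorem le_mms {P : Fin n → Finset (Fin m)} (hP : IsAllocation P) {c : ℚ}
    (hc : ∀ j, c ≤ f (P j)) : c ≤ mms n f := by
  refine le_trans ?_ (Finset.le_sup' _ (b := P) (by simpa [partitionings] using hP))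
  exact Finset.le_inf' _ _ fun j _ => hc j

/-- `v` is the `n`-th largest value of a single item, or the value of the empty set
if there are fewer than `n` items. -/
structure IsNthValue (n : ℕ) (f : Finset (Fin m) → ℚ) (v : ℚ) : Prop where
  empty_le : f ∅ ≤ v
  single_le : ∀ b, n ≤ (Finset.univ.filter fun c => f {b} ≤ f {c}).card → f {b} ≤ v
  attained : v = f ∅ ∨ ∃ b, v = f {b} ∧ n ≤ (Finset.univ.filter fun c => f {b} ≤ f {c}).card

theorem isAllocation_fibers {n : ℕ} (g : Fin m → Fin n) :
    IsAllocation (fun i => Finset.univ.filter fun b => g b = i) where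
  disjoint i j hij := by
    rw [Finset.disjoint_left]
    intro b hi hj
    simp only [Finset.mem_filter, Finset.mem_univ, true_and] at hi hj
    exact hij (hi.symm.trans hj)
  union := by ext b; simp

/-- Put `n` items worth at least `v` into different bundles and everything else into bundle `0`;
monotonicity does the rest. -/
theorem IsNthValue.le_mms {v : ℚ} (hv : IsNthValue n f v) (hf : IsSubmodularValuation f) :
    v ≤ mms n f := by
  rcases hv.attained with rfl | ⟨b, rfl, hb⟩
  · exact FairAllocation.le_mms (isAllocation_fibers fun _ => 0)
      fun j => hf.mono (Finset.empty_subset _)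
  · obtain ⟨e⟩ : Nonempty (Fin n ↪ {c // c ∈ Finset.univ.filter fun c => f {b} ≤ f {c}}) :=
      Function.Embedding.nonempty_of_card_le
        (by simpa only [Fintype.card_fin, Fintype.card_coe] using hb)
    have he : Function.Injective fun j => (e j : Fin m) :=
      Subtype.val_injective.comp e.injective
    refine FairAllocation.le_mms
      (isAllocation_fibers (Function.extend (fun j => (e j : Fin m)) id fun _ => 0)) fun j => ?_
    have h := (e j).2
    simp only [Finset.mem_filter, Finset.mem_univ, true_and] at h
    refine h.trans (hf.mono ?_)
    simp [he.extend_apply]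

/-- A set of `L` items meets at most `L.card` bundles. -/
theorem IsAllocation.le_card_add_card_disjoint {n : ℕ} {P : Fin n → Finset (Fin m)}
    (hP : IsAllocation P) (L : Finset (Fin m)) :
    n ≤ L.card + (Finset.univ.filter fun j => Disjoint (P j) L).card := by
  have hbad : (Finset.univ.filter fun j => ¬ Disjoint (P j) L).card ≤ L.card := by
    refine Finset.card_le_card_of_forall_subsingleton (fun j b => b ∈ P j ∧ b ∈ L) ?_ ?_
    · intro j hj
      obtain ⟨b, hb⟩ := Finset.not_disjoint_iff.mp (Finset.mem_filter.mp hj).2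
      exact ⟨b, hb.2, hb⟩
    · intro b _ i hi j hj
      by_contra hne
      exact Finset.disjoint_left.mp (hP.disjoint i j hne) hi.2.1 hj.2.1
  have h := Finset.card_filter_add_card_filter_not (s := (Finset.univ : Finset (Fin n)))
    (fun j => Disjoint (P j) L)
  rw [Finset.card_univ, Fintype.card_fin] at h
  omega

/-- Fewer than `n` items are worth more than `v`, so some bundle of an optimal partition contains
none of them. By subadditivity it is worth at most `f ∅` plus `v` for each of its at most `m` items.
-/
theorem IsNthValue.mms_le {v : ℚ} (hv : IsNthValue n f v) (hf : IsSubmodularValuation f) :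
    mms n f ≤ v * (m + 1) := by
  obtain ⟨P, hP, hmms⟩ := exists_partition_mms (n := n) f
  set H : Finset (Fin m) := Finset.univ.filter fun b => v < f {b} with hH
  have hcard : H.card < n := by
    by_contra! hn
    have hne : H.Nonempty := by
      rw [← Finset.card_pos]; exact lt_of_lt_of_le (Nat.pos_of_neZero n) hn
    obtain ⟨b, hb, hmin⟩ := H.exists_min_image (fun b => f {b}) hne
    -- The cheapest item of `H` is matched by all of `H`, hence by at least `n` items, so it cannot
    -- exceed `v`.
    have h := hv.single_le b (hn.trans (Finset.card_le_card fun c hc => by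
      simpa using hmin c hc))
    simp only [hH, Finset.mem_filter, Finset.mem_univ, true_and] at hb
    exact absurd h (not_le.mpr hb)
  obtain ⟨j, hj⟩ : ∃ j, Disjoint (P j) H := by
    have h := hP.le_card_add_card_disjoint H
    obtain ⟨j, hj⟩ := Finset.card_pos.mp (by omega : 0 < (Finset.univ.filter fun j =>
      Disjoint (P j) H).card)
    exact ⟨j, by simpa using hj⟩
  have hv0 : 0 ≤ v := (hf.nonneg ∅).trans hv.empty_le
  have h₁ := hf.le_sum_insert ∅ (P j)
  have h₂ : ∑ b ∈ P j, (f (insert b ∅) - f ∅) ≤ ∑ b ∈ P j, v := by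
    refine Finset.sum_le_sum fun b hb => ?_
    have hbH : b ∉ H := Finset.disjoint_left.mp hj hb
    simp only [hH, Finset.mem_filter, Finset.mem_univ, true_and, not_lt] at hbH
    simp only [insert_empty_eq]
    linarith [hf.nonneg ∅]
  have h₃ : ((P j).card : ℚ) ≤ m := by
    have := Finset.card_le_univ (P j)
    rw [Fintype.card_fin] at this
    exact_mod_cast this
  rw [Finset.sum_const, nsmul_eq_mul] at h₂
  rw [Finset.empty_union] at h₁
  nlinarith [hmms j, hv.empty_le, mul_le_mul_of_nonneg_right h₃ hv0]

end Mms

/-! ### Local search -/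

section LocalSearch

variable {n m : ℕ}

/-- The items owned by agent `i`. -/
def bundle (own : Fin m → Fin n) (i : Fin n) : Finset (Fin m) :=
  Finset.univ.filter fun b => own b = i

@[simp] theorem mem_bundle {own : Fin m → Fin n} {i : Fin n} {b : Fin m} :
    b ∈ bundle own i ↔ own b = i := by simp [bundle]

theorem bundle_update_self (own : Fin m → Fin n) (i : Fin n) (b : Fin m) :
    bundle (Function.update own b i) i = insert b (bundle own i) := by
  ext c
  by_cases h : c = b <;> simp [h]

theorem bundle_update_old (own : Fin m → Fin n) {i : Fin n} {b : Fin m} (hi : own b ≠ i) :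
    bundle (Function.update own b i) (own b) = (bundle own (own b)).erase b := by
  ext c
  by_cases h : c = b <;> simp [h, hi.symm]

theorem bundle_update_of_ne (own : Fin m → Fin n) {i k : Fin n} {b : Fin m} (hi : k ≠ i)
    (hk : k ≠ own b) : bundle (Function.update own b i) k = bundle own k := by
  ext c
  by_cases h : c = b <;> simp [h, hi.symm, hk.symm]

/-- The value of `S` for agent `i` relative to the threshold `T i`, capped at `2 / 3`.
It is `0` for agents with threshold `0`. -/
def capped (V : Fin n → Finset (Fin m) → ℚ) (T : Fin n → ℚ) (i : Fin n)
    (S : Finset (Fin m)) : ℚ :=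
  min (V i S / T i) (2 / 3)

/-- The potential function of the local search. -/
def potential (V : Fin n → Finset (Fin m) → ℚ) (T : Fin n → ℚ) (own : Fin m → Fin n) : ℚ :=
  ∑ i, capped V T i (bundle own i)

/-- Agent `i` is below a third of its threshold, and giving it the unlocked item `b` raises the
potential noticeably. -/
structure Improving (V : Fin n → Finset (Fin m) → ℚ) (T : Fin n → ℚ) (lock : Finset (Fin m))
    (own : Fin m → Fin n) (i : Fin n) (b : Fin m) : Prop where
  notMem : b ∉ lock
  unsatisfied : 3 * V i (bundle own i) < T i
  gain : capped V T (own b) (bundle own (own b)) <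
    V i (insert b (bundle own i)) / T i - V i (bundle own i) / T i - 1 / (3 * m) +
      capped V T (own b) ((bundle own (own b)).erase b)

variable {V : Fin n → Finset (Fin m) → ℚ} {T : Fin n → ℚ} {lock : Finset (Fin m)}
  {own : Fin m → Fin n}

theorem isSubmodularValuation_capped (hV : ∀ i, IsSubmodularValuation (V i)) (hT : ∀ i, 0 ≤ T i)
    (i : Fin n) : IsSubmodularValuation (capped V T i) :=
  ((hV i).div_const (hT i)).min_const (by norm_num)

theorem potential_nonneg (hV : ∀ i, IsSubmodularValuation (V i)) (hT : ∀ i, 0 ≤ T i) :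
    0 ≤ potential V T own :=
  Finset.sum_nonneg fun i _ => (isSubmodularValuation_capped hV hT i).nonneg _

/-- Strict because the cap is below `1`; the strictness excludes a further move once the iteration
budget is used up. -/
theorem potential_lt [NeZero n] : potential V T own < n := by
  have h : potential V T own ≤ ∑ _i : Fin n, (2 / 3 : ℚ) :=
    Finset.sum_le_sum fun i _ => min_le_right _ _
  have hn : (0 : ℚ) < n := by exact_mod_cast Nat.pos_of_neZero n
  rw [Finset.sum_const, Finset.card_univ, Fintype.card_fin, nsmul_eq_mul] at h
  linarith

/-- Only the bundles of `i` and of the old owner change. The cap is inactive for `i` before the move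
(value below `1 / 3`) and after it (one item below `1 / 3` is added), so the uncapped gain in
`Improving` is the true change of that summand. -/
theorem Improving.potential_add_lt (hV : ∀ i, IsSubmodularValuation (V i)) (hT : ∀ i, 0 ≤ T i)
    (hsmall : ∀ i b, 0 < T i → b ∉ lock → 3 * V i {b} < T i) {i : Fin n} {b : Fin m}
    (h : Improving V T lock own i b) :
    potential V T own + 1 / (3 * m) < potential V T (Function.update own b i) := by
  have hTi : 0 < T i := lt_of_le_of_lt (by linarith [(hV i).nonneg (bundle own i)]) h.unsatisfied
  have hε : (0 : ℚ) ≤ 1 / (3 * m) := by positivity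
  have hgain := h.gain
  -- Moving an item to its own owner would gain nothing, lose something non-negative and still have
  -- to beat the slack.
  have hki : own b ≠ i := by
    intro hk
    have hins : insert b (bundle own i) = bundle own i := by simp [hk]
    have := (isSubmodularValuation_capped hV hT (own b)).mono
      (Finset.erase_subset b (bundle own (own b)))
    rw [hins] at hgain
    linarith
  have hold : capped V T i (bundle own i) = V i (bundle own i) / T i :=
    min_eq_left (by rw [div_le_iff₀ hTi]; linarith [h.unsatisfied])
  have hnew : capped V T i (insert b (bundle own i)) = V i (insert b (bundle own i)) / T i := by
    refine min_eq_left ?_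
    rw [div_le_iff₀ hTi]
    linarith [h.unsatisfied, hsmall i b hTi h.notMem, (hV i).insert_le (bundle own i) b]
  have hsum : potential V T (Function.update own b i) - potential V T own =
      (capped V T i (insert b (bundle own i)) - capped V T i (bundle own i)) +
      (capped V T (own b) ((bundle own (own b)).erase b) -
        capped V T (own b) (bundle own (own b))) := by
    rw [potential, potential, ← Finset.sum_sub_distrib, Finset.sum_eq_add i (own b) hki.symm,
      bundle_update_self, bundle_update_old own hki]
    · intro k _ hk
      rw [bundle_update_of_ne own hk.1 hk.2, sub_self]
    · simp
    · simp
  rw [hold, hnew] at hsum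
  linarith

/-- If no move is improving and agent `i` is below a third of its threshold, then that threshold
noticeably exceeds the maxmin value. -/
theorem mms_lt_of_stable [NeZero n] (hV : ∀ i, IsSubmodularValuation (V i)) (hT : ∀ i, 0 ≤ T i)
    (hlock : lock.card + (Finset.univ.filter fun k => 0 < T k).card ≤ n) {i : Fin n}
    (hstable : ∀ b, ¬ Improving V T lock own i b) (hi : 3 * V i (bundle own i) < T i) :
    mms n (V i) < T i * (1 - 1 / (3 * n)) := by
  obtain ⟨P, hP, hmms⟩ := exists_partition_mms (n := n) (V i)
  have hTi : 0 < T i := lt_of_le_of_lt (by linarith [(hV i).nonneg (bundle own i)]) hi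
  set A := bundle own i with hA
  set μ := mms n (V i)
  set R := Finset.univ.filter fun k => 0 < T k with hR
  set G := Finset.univ.filter fun j => Disjoint (P j) lock with hG
  have hiR : i ∈ R := by simp [hR, hTi]
  have hRpos : (1 : ℚ) ≤ R.card := by exact_mod_cast Finset.card_pos.mpr ⟨i, hiR⟩
  have hRn : (R.card : ℚ) ≤ n := by exact_mod_cast (by omega : R.card ≤ n)
  have hn : (1 : ℚ) ≤ n := hRpos.trans hRn
  have hn3 : (1 : ℚ) / (3 * n) ≤ 1 / (3 * R.card) :=
    one_div_le_one_div_of_le (by linarith) (by linarith)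
  have hR3 : (1 : ℚ) / (3 * R.card) ≤ 1 / 3 :=
    one_div_le_one_div_of_le (by norm_num) (by linarith)
  -- If `μ < V i A`, then `μ` is below `T i / 3`, which is already enough. The other case makes `μ -
  -- V i A` non-negative, so that `G.card` can be replaced by `R.card`.
  rcases lt_or_ge μ (V i A) with hμ | hμ
  · nlinarith
  have hGcard : (R.card : ℚ) ≤ G.card := by
    have : n ≤ lock.card + G.card := hP.le_card_add_card_disjoint lock
    exact_mod_cast (by omega : R.card ≤ G.card)
  have hcapped := isSubmodularValuation_capped hV hT
  set gain : Fin m → ℚ := fun b => V i (insert b A) - V i A with hgain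
  have hgain0 : ∀ b, 0 ≤ gain b := fun b =>
    sub_nonneg.mpr ((hV i).mono (Finset.subset_insert b A))
  set loss : Fin m → ℚ := fun b => capped V T (own b) (bundle own (own b)) -
    capped V T (own b) ((bundle own (own b)).erase b) with hloss
  have hloss0 : ∀ b, 0 ≤ loss b := fun b =>
    sub_nonneg.mpr ((hcapped (own b)).mono (Finset.erase_subset _ _))
  -- The bundles in `G` are disjoint and avoid the locked items, and adding any one of them to `A`
  -- raises the value to at least `μ`.
  have hgains : G.card * (μ - V i A) ≤ ∑ b ∈ lockᶜ, gain b := by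
    have h₁ : ∑ j ∈ G, ∑ b ∈ P j, gain b ≤ ∑ b ∈ lockᶜ, gain b := by
      rw [← Finset.sum_biUnion fun j _ k _ hjk => hP.disjoint j k hjk]
      refine Finset.sum_le_sum_of_subset_of_nonneg ?_ fun b _ _ => hgain0 b
      intro b hb
      obtain ⟨j, hj, hbj⟩ := Finset.mem_biUnion.mp hb
      exact Finset.mem_compl.mpr (Finset.disjoint_left.mp (Finset.mem_filter.mp hj).2 hbj)
    have h₂ : ∑ j ∈ G, (μ - V i A) ≤ ∑ j ∈ G, ∑ b ∈ P j, gain b := by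
      refine Finset.sum_le_sum fun j _ => le_trans ?_ ((hV i).le_sum_insert A (P j))
      linarith [hmms j, (hV i).mono (Finset.subset_union_right : P j ⊆ A ∪ P j)]
    rw [Finset.sum_const, nsmul_eq_mul] at h₂
    exact h₂.trans h₁
  -- Items that `i` already owns have gain `0`; for all others this is the failed improvement test,
  -- multiplied by `T i`.
  have hpoint : ∀ b ∈ lockᶜ, gain b ≤ T i * ((if own b = i then 0 else loss b) + 1 / (3 * m)) := by
    intro b hb
    by_cases hbi : own b = i
    · have hins : insert b A = A := by simp [hA, hbi]
      simp only [hgain, hins, sub_self, hbi, if_true, zero_add]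
      positivity
    · have h : ¬ _ := fun hg => hstable b ⟨Finset.mem_compl.mp hb, hi, hg⟩
      rw [not_lt, div_sub_div_same] at h
      rw [if_neg hbi, mul_comm, ← div_le_iff₀ hTi]
      linarith
  -- Group the items by owner: the capped losses in a bundle sum to at most its capped value. That
  -- is `2 / 3` at most, and `0` for owners with threshold `0`, because division by `0` gives `0`;
  -- agent `i` itself is left out.
  have hlosses : ∑ b ∈ lockᶜ, (if own b = i then 0 else loss b) ≤ (R.card - 1) * (2 / 3) := by
    calc ∑ b ∈ lockᶜ, (if own b = i then 0 else loss b)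
        ≤ ∑ b, (if own b = i then 0 else loss b) := by
          refine Finset.sum_le_sum_of_subset_of_nonneg (Finset.subset_univ _) fun b _ _ => ?_
          split_ifs
          exacts [le_rfl, hloss0 b]
      _ = ∑ k, ∑ b ∈ bundle own k, (if own b = i then 0 else loss b) :=
          (Finset.sum_fiberwise _ _ _).symm
      _ ≤ ∑ k, (if k ∈ R.erase i then (2 / 3 : ℚ) else 0) := by
          refine Finset.sum_le_sum fun k _ => ?_
          by_cases hki : k = i
          · refine le_of_eq_of_le (Finset.sum_eq_zero fun b hb => ?_) (by split_ifs <;> norm_num)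
            rw [if_pos ((mem_bundle.mp hb).trans hki)]
          · have h : ∑ b ∈ bundle own k, (if own b = i then 0 else loss b) ≤
                capped V T k (bundle own k) := by
              refine le_of_eq_of_le (Finset.sum_congr rfl fun b hb => ?_)
                ((hcapped k).sum_erase_le (bundle own k))
              have hbk := mem_bundle.mp hb
              rw [if_neg (by rwa [hbk])]
              simp only [hloss, hbk]
            refine h.trans ?_
            by_cases hk : 0 < T k
            · rw [if_pos (by simp [hR, hki, hk])]
              exact min_le_right _ _
            · have hk0 : T k = 0 := le_antisymm (not_lt.mp hk) (hT k)
              rw [if_neg (by simp [hR, hk])]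
              refine (min_le_left _ _).trans ?_
              rw [hk0, div_zero]
      _ = (R.card - 1) * (2 / 3) := by
          rw [Finset.sum_ite_mem, Finset.univ_inter, Finset.sum_const, nsmul_eq_mul,
            Finset.card_erase_of_mem hiR, Nat.cast_sub (Finset.card_pos.mpr ⟨i, hiR⟩),
            Nat.cast_one]
  have hε : ∑ _b ∈ lockᶜ, (1 / (3 * m) : ℚ) ≤ 1 / 3 := by
    have hle : (lockᶜ.card : ℚ) ≤ m := by
      have := Finset.card_le_univ lockᶜ
      rw [Fintype.card_fin] at this
      exact_mod_cast this
    rw [Finset.sum_const, nsmul_eq_mul]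
    rcases Nat.eq_zero_or_pos m with rfl | hm
    · norm_num
    · have hm' : (0 : ℚ) < m := by exact_mod_cast hm
      rw [mul_one_div, div_le_iff₀ (by positivity)]
      linarith
  have htotal : R.card * (μ - V i A) ≤ T i * ((R.card - 1) * (2 / 3) + 1 / 3) :=
    calc R.card * (μ - V i A) ≤ G.card * (μ - V i A) :=
          mul_le_mul_of_nonneg_right hGcard (sub_nonneg.mpr hμ)
      _ ≤ _ := hgains
      _ ≤ _ := Finset.sum_le_sum hpoint
      _ ≤ _ := by
          rw [← Finset.mul_sum, Finset.sum_add_distrib]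
          exact mul_le_mul_of_nonneg_left (add_le_add hlosses hε) hTi.le
  have hfinal : μ < T i * (1 - 1 / (3 * R.card)) := by
    -- With `V i A < T i / 3` the coefficient of `T i` is `(r - 1) * (2 / 3) + 1 / 3 + r / 3 = r - 1
    -- / 3`, where `r = R.card`.
    have h₁ : R.card * μ < T i * (R.card - 1 / 3) := by
      nlinarith [mul_lt_mul_of_pos_left hi (by linarith : (0 : ℚ) < R.card)]
    have h₂ : T i * (1 - 1 / (3 * R.card)) = T i * (R.card - 1 / 3) / R.card := by
      field_simp
    rw [h₂, lt_div_iff₀ (by linarith)]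
    linarith
  exact hfinal.trans_le (mul_le_mul_of_nonneg_left (by linarith) hTi.le)

end LocalSearch

/-! ### Bit lengths -/

theorem size_le_self (k : ℕ) : k.size ≤ k := Nat.size_le.mpr k.lt_two_pow_self

theorem size_mul_le (a b : ℕ) : (a * b).size ≤ a.size + b.size := by
  rw [Nat.size_le, pow_add]
  exact Nat.mul_lt_mul'' a.lt_size_self b.lt_size_self

theorem size_add_le (a b : ℕ) : (a + b).size ≤ a.size + b.size + 1 := by
  rw [Nat.size_le]
  have ha : a < 2 ^ (a.size + b.size) :=
    a.lt_size_self.trans_le (Nat.pow_le_pow_right two_pos (Nat.le_add_right _ _))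
  have hb : b < 2 ^ (a.size + b.size) :=
    b.lt_size_self.trans_le (Nat.pow_le_pow_right two_pos (Nat.le_add_left _ _))
  rw [pow_succ]
  omega

/-- The reduced numerator and denominator divide those of any other representation. -/
theorem ratBits_le_of_eq_div {q : ℚ} {a b : ℤ} (hb : b ≠ 0) (h : q = a / b) :
    ratBits q ≤ a.natAbs.size + b.natAbs.size := by
  rcases eq_or_ne a 0 with rfl | ha
  · have hb' : 1 ≤ b.natAbs.size := Nat.size_pos.mpr (Int.natAbs_pos.mpr hb)
    have hq : q = 0 := by simpa using h
    simpa [hq, ratBits] using hb'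
  · obtain rfl : q = Rat.divInt a b := by rw [h, Rat.divInt_eq_div]
    refine Nat.add_le_add (Nat.size_le_size ?_) (Nat.size_le_size ?_)
    · exact Nat.le_of_dvd (Int.natAbs_pos.mpr ha)
        (Int.natAbs_dvd_natAbs.mpr (Rat.num_dvd a hb))
    · have h := Int.natAbs_dvd_natAbs.mpr (Rat.den_dvd a b)
      exact Nat.le_of_dvd (Int.natAbs_pos.mpr hb) (by simpa using h)

theorem ratBits_mul_le (x y : ℚ) : ratBits (x * y) ≤ ratBits x + ratBits y := by
  have h := ratBits_le_of_eq_div (q := x * y) (a := x.num * y.num) (b := x.den * y.den)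
    (by exact_mod_cast (Nat.mul_pos x.den_pos y.den_pos).ne')
    (by
      push_cast
      rw [← div_mul_div_comm, Rat.num_div_den, Rat.num_div_den])
  simp only [Int.natAbs_mul, Int.natAbs_natCast] at h
  have h₁ := size_mul_le x.num.natAbs y.num.natAbs
  have h₂ := size_mul_le x.den y.den
  simp only [ratBits] at *
  omega

/-- Cross-multiplication may double the length. This is harmless: expressions have fixed depth and
the allocation program never stores a computed sum. -/
theorem ratBits_add_le (x y : ℚ) : ratBits (x + y) ≤ 2 * (ratBits x + ratBits y) + 1 := by
  have h := ratBits_le_of_eq_div (q := x + y) (a := x.num * y.den + y.num * x.den)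
    (b := x.den * y.den) (by exact_mod_cast (Nat.mul_pos x.den_pos y.den_pos).ne')
    (by
      have hx : (x.den : ℚ) ≠ 0 := by exact_mod_cast x.den_pos.ne'
      have hy : (y.den : ℚ) ≠ 0 := by exact_mod_cast y.den_pos.ne'
      push_cast
      conv_lhs => rw [← Rat.num_div_den x, ← Rat.num_div_den y]
      field_simp)
  simp only [Int.natAbs_mul, Int.natAbs_natCast] at h
  have h₀ : (x.num * y.den + y.num * x.den).natAbs ≤
      x.num.natAbs * y.den + y.num.natAbs * x.den := by
    refine (Int.natAbs_add_le _ _).trans ?_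
    simp [Int.natAbs_mul]
  have h₁ := (Nat.size_le_size h₀).trans (size_add_le _ _)
  have h₂ := size_mul_le x.num.natAbs y.den
  have h₃ := size_mul_le y.num.natAbs x.den
  have h₄ := size_mul_le x.den y.den
  simp only [ratBits] at *
  omega

theorem ratBits_neg (x : ℚ) : ratBits (-x) = ratBits x := by simp [ratBits]

theorem ratBits_sub_le (x y : ℚ) : ratBits (x - y) ≤ 2 * (ratBits x + ratBits y) + 1 := by
  rw [sub_eq_add_neg, ← ratBits_neg y]
  exact ratBits_add_le _ _

theorem ratBits_inv_le (x : ℚ) : ratBits x⁻¹ ≤ ratBits x := by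
  rcases eq_or_ne x 0 with rfl | hx
  · simp
  · have h := ratBits_le_of_eq_div (q := x⁻¹) (a := x.den) (b := x.num)
      (Rat.num_ne_zero.mpr hx) (by
        conv_lhs => rw [← Rat.num_div_den x, inv_div]
        simp)
    simp only [ratBits, Int.natAbs_natCast] at *
    omega

theorem ratBits_div_le (x y : ℚ) : ratBits (x / y) ≤ ratBits x + ratBits y := by
  rw [div_eq_mul_inv]
  exact (ratBits_mul_le _ _).trans (Nat.add_le_add_left (ratBits_inv_le y) _)

theorem ratBits_natCast_le (k : ℕ) : ratBits (k : ℚ) ≤ k + 1 := by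
  have := size_le_self k
  simp [ratBits]
  omega

/-! ### Static bounds for the running time -/

/-- All numbers stored in the memory are small. -/
structure Memory.Bounded (N : ℕ) (s : Memory) : Prop where
  idx_le : ∀ a k, s.idx a k ≤ N
  val_le : ∀ a k, ratBits (s.val a k) ≤ N

open Polynomial

namespace IdxExpr

/-- Bound for the value of an expression in a bounded memory. -/
noncomputable def evalBound : IdxExpr → ℕ[X]
  | const k => C k
  | load _ _ => X
  | add x y => x.evalBound + y.evalBound
  | sub x _ => x.evalBound
  | mul x y => x.evalBound * y.evalBound

/-- Bound for the cost of an expression in a bounded memory. -/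
noncomputable def costBound : IdxExpr → ℕ[X]
  | const k => 1 + C k
  | load _ i => i.costBound + 1 + X
  | add x y => x.costBound + y.costBound + 1 + (x.evalBound + y.evalBound)
  | sub x y => x.costBound + y.costBound + 1 + x.evalBound
  | mul x y => x.costBound + y.costBound + 1 + x.evalBound * y.evalBound

theorem eval_le {N : ℕ} {s : Memory} (hs : s.Bounded N) (e : IdxExpr) :
    e.eval s ≤ e.evalBound.eval N := by
  induction e with
  | const k => simp [eval, evalBound]
  | load a i => simpa [eval, evalBound] using hs.idx_le _ _
  | add x y hx hy => simpa [eval, evalBound] using Nat.add_le_add hx hy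
  | sub x y hx hy => simpa [eval, evalBound] using (Nat.sub_le _ _).trans hx
  | mul x y hx hy => simpa [eval, evalBound] using Nat.mul_le_mul hx hy

/-- Bounding bits by magnitude is crude, but suffices because all indices and counters are
polynomially large. -/
theorem size_eval_le {N : ℕ} {s : Memory} (hs : s.Bounded N) (e : IdxExpr) :
    (e.eval s).size ≤ e.evalBound.eval N :=
  (size_le_self _).trans (eval_le hs e)

theorem cost_le {N : ℕ} {s : Memory} (hs : s.Bounded N) (e : IdxExpr) :
    e.cost s ≤ e.costBound.eval N := by
  induction e with
  | const k => simpa [cost, costBound] using size_le_self k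
  | load a i hi =>
    have h := size_eval_le hs (load a i)
    simp only [eval, evalBound, eval_X] at h
    simp only [cost, costBound, eval_add, eval_one, eval_X]
    omega
  | add x y hx hy =>
    have h := size_eval_le hs (add x y)
    simp only [eval, evalBound, eval_add] at h
    simp only [cost, costBound, eval_add, eval_one]
    omega
  | sub x y hx hy =>
    have h := size_eval_le hs (sub x y)
    simp only [eval, evalBound] at h
    simp only [cost, costBound, eval_add, eval_one]
    omega
  | mul x y hx hy =>
    have h := size_eval_le hs (mul x y)
    simp only [eval, evalBound, eval_mul] at h
    simp only [cost, costBound, eval_add, eval_mul, eval_one]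
    omega

end IdxExpr

namespace ValExpr

/-- Bound for the bits of the value of an expression in a bounded memory. -/
noncomputable def bitsBound : ValExpr → ℕ[X]
  | const q => C (ratBits q)
  | load _ _ => X
  | ofIdx i => i.evalBound + 1
  | add x y => 2 * (x.bitsBound + y.bitsBound) + 1
  | sub x y => 2 * (x.bitsBound + y.bitsBound) + 1
  | mul x y => x.bitsBound + y.bitsBound
  | div x y => x.bitsBound + y.bitsBound

/-- Bound for the cost of an expression in a bounded memory. -/
noncomputable def costBound : ValExpr → ℕ[X]
  | const q => 1 + C (ratBits q)
  | load _ i => i.costBound + 1 + X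
  | ofIdx i => i.costBound + 1 + (i.evalBound + 1)
  | add x y => x.costBound + y.costBound + 1 + (2 * (x.bitsBound + y.bitsBound) + 1)
  | sub x y => x.costBound + y.costBound + 1 + (2 * (x.bitsBound + y.bitsBound) + 1)
  | mul x y => x.costBound + y.costBound + 1 + (x.bitsBound + y.bitsBound)
  | div x y => x.costBound + y.costBound + 1 + (x.bitsBound + y.bitsBound)

theorem ratBits_eval_le {N : ℕ} {s : Memory} (hs : s.Bounded N) (e : ValExpr) :
    ratBits (e.eval s) ≤ e.bitsBound.eval N := by
  induction e with
  | const q => simp [eval, bitsBound]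
  | load a i => simpa [eval, bitsBound] using hs.val_le _ _
  | ofIdx i =>
    simpa [eval, bitsBound] using
      (ratBits_natCast_le _).trans (Nat.add_le_add_right (i.eval_le hs) 1)
  | add x y hx hy =>
    have := ratBits_add_le (x.eval s) (y.eval s)
    simp [eval, bitsBound]
    omega
  | sub x y hx hy =>
    have := ratBits_sub_le (x.eval s) (y.eval s)
    simp [eval, bitsBound]
    omega
  | mul x y hx hy =>
    simpa [eval, bitsBound] using (ratBits_mul_le _ _).trans (Nat.add_le_add hx hy)
  | div x y hx hy =>
    simpa [eval, bitsBound] using (ratBits_div_le _ _).trans (Nat.add_le_add hx hy)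

theorem cost_le {N : ℕ} {s : Memory} (hs : s.Bounded N) (e : ValExpr) :
    e.cost s ≤ e.costBound.eval N := by
  induction e with
  | const q => simp [cost, costBound]
  | load a i =>
    have h := ratBits_eval_le hs (load a i)
    have hi := i.cost_le hs
    simp only [eval, bitsBound, eval_X] at h
    simp only [cost, costBound, eval_add, eval_one, eval_X]
    omega
  | ofIdx i =>
    have h := ratBits_eval_le hs (ofIdx i)
    have hi := i.cost_le hs
    simp only [eval, bitsBound, eval_add, eval_one] at h
    simp only [cost, costBound, eval_add, eval_one]
    omega
  | add x y hx hy =>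
    have h := ratBits_eval_le hs (add x y)
    simp only [eval, bitsBound, eval_add, eval_mul, eval_one] at h
    simp only [cost, costBound, eval_add, eval_mul, eval_one]
    omega
  | sub x y hx hy =>
    have h := ratBits_eval_le hs (sub x y)
    simp only [eval, bitsBound, eval_add, eval_mul, eval_one] at h
    simp only [cost, costBound, eval_add, eval_mul, eval_one]
    omega
  | mul x y hx hy =>
    have h := ratBits_eval_le hs (mul x y)
    simp only [eval, bitsBound, eval_add] at h
    simp only [cost, costBound, eval_add, eval_one]
    omega
  | div x y hx hy =>
    have h := ratBits_eval_le hs (div x y)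
    simp only [eval, bitsBound, eval_add] at h
    simp only [cost, costBound, eval_add, eval_one]
    omega

end ValExpr

namespace Test

/-- Bound for the cost of a test in a bounded memory. -/
noncomputable def costBound : Test → ℕ[X]
  | idxLe x y => x.costBound + y.costBound + 1
  | valLe x y => x.costBound + y.costBound + 1
  | not b => b.costBound + 1
  | and b c => b.costBound + c.costBound + 1

theorem cost_le {N : ℕ} {s : Memory} (hs : s.Bounded N) (b : Test) :
    b.cost s ≤ b.costBound.eval N := by
  induction b with
  | idxLe x y =>
    simpa [cost, costBound] using Nat.add_le_add (x.cost_le hs) (y.cost_le hs)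
  | valLe x y =>
    simpa [cost, costBound] using Nat.add_le_add (x.cost_le hs) (y.cost_le hs)
  | not b hb => simpa [cost, costBound] using hb
  | and b c hb hc => simpa [cost, costBound] using Nat.add_le_add hb hc

end Test

namespace Program

/-- Bound for the running time of a program, at number `N`, if the memory stays bounded by `N`
and every loop makes at most `N` iterations. -/
noncomputable def costBound : Program → ℕ[X]
  | skip => 1
  | setIdx _ i x => i.costBound + x.costBound + 1
  | setVal _ i x => i.costBound + x.costBound + 1
  | query _ i k _ => i.costBound + k.costBound + 1 + X
  | seq p q => p.costBound + q.costBound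
  | ite b p q => b.costBound + 1 + (p.costBound + q.costBound)
  | loop b p => X * (b.costBound + 1 + p.costBound) + (b.costBound + 1)

end Program

/-! ### Total correctness with time bounds -/

section Triples

variable {n m : ℕ} {V : Fin n → Finset (Fin m) → ℚ} {N : ℕ} {α : Type*}

/-- Started in `s`, the program halts within its static time bound, in a memory
satisfying `Q`. -/
def Reaches (V : Fin n → Finset (Fin m) → ℚ) (N : ℕ) (P : Program) (s : Memory)
    (Q : Memory → Prop) : Prop :=
  ∃ c s', Runs V P s c s' ∧ c ≤ P.costBound.eval N ∧ Q s'

/-- Let `R` say that a memory represents an abstract state. Started in any memory representing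
`x`, the program halts within its static time bound, in a memory representing some abstract
state that satisfies `Q`. -/
def Triple (V : Fin n → Finset (Fin m) → ℚ) (N : ℕ) (R : Memory → α → Prop) (P : Program) (x : α)
    (Q : α → Prop) : Prop :=
  ∀ s, R s x → Reaches V N P s fun s' => ∃ x', R s' x' ∧ Q x'

variable {R : Memory → α → Prop} {P P' : Program} {x : α} {Q : α → Prop}

theorem Triple.mono {Q' : α → Prop} (h : Triple V N R P x Q') (hQ : ∀ y, Q' y → Q y) :
    Triple V N R P x Q := by
  intro s hs
  obtain ⟨c, s', hrun, hc, x', hx', hq⟩ := h s hs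
  exact ⟨c, s', hrun, hc, x', hx', hQ x' hq⟩

theorem Triple.skip (h : Q x) : Triple V N R Program.skip x Q :=
  fun s hs => ⟨1, s, Runs.skip s, by simp [Program.costBound], x, hs, h⟩

theorem Triple.seq (h : Triple V N R P x fun y => Triple V N R P' y Q) :
    Triple V N R (Program.seq P P') x Q := by
  intro s hs
  obtain ⟨c, s', hrun, hc, x', hx', h'⟩ := h s hs
  obtain ⟨c', s'', hrun', hc', hq⟩ := h' s' hx'
  refine ⟨c + c', s'', hrun.seq hrun', ?_, hq⟩
  simpa [Program.costBound] using Nat.add_le_add hc hc'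

theorem Triple.setIdx (hR : ∀ s x, R s x → s.Bounded N) {a : ℕ} {i e : IdxExpr} (y : α)
    (hy : ∀ s, R s x → R (s.setIdx a (i.eval s) (e.eval s)) y) (hQ : Q y) :
    Triple V N R (Program.setIdx a i e) x Q := by
  intro s hs
  refine ⟨_, _, Runs.setIdx s a i e, ?_, y, hy s hs, hQ⟩
  have h₁ := i.cost_le (hR s x hs)
  have h₂ := e.cost_le (hR s x hs)
  simpa [Program.costBound] using Nat.add_le_add h₁ h₂

theorem Triple.setVal (hR : ∀ s x, R s x → s.Bounded N) {a : ℕ} {i : IdxExpr} {e : ValExpr}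
    (y : α) (hy : ∀ s, R s x → R (s.setVal a (i.eval s) (e.eval s)) y) (hQ : Q y) :
    Triple V N R (Program.setVal a i e) x Q := by
  intro s hs
  refine ⟨_, _, Runs.setVal s a i e, ?_, y, hy s hs, hQ⟩
  have h₁ := i.cost_le (hR s x hs)
  have h₂ := e.cost_le (hR s x hs)
  simpa [Program.costBound] using Nat.add_le_add h₁ h₂

theorem Triple.query (hR : ∀ s x, R s x → s.Bounded N)
    (hN : ∀ k S, ratBits (valueOracle V k S) ≤ N) {a t : ℕ} {i k : IdxExpr} (y : α)
    (hy : ∀ s, R s x →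
      R (s.setVal a (i.eval s) (valueOracle V (k.eval s) (s.itemSet m t))) y) (hQ : Q y) :
    Triple V N R (Program.query a i k t) x Q := by
  intro s hs
  refine ⟨_, _, Runs.query s a i k t, ?_, y, hy s hs, hQ⟩
  have h₁ := i.cost_le (hR s x hs)
  have h₂ := k.cost_le (hR s x hs)
  have h₃ := hN (k.eval s) (s.itemSet m t)
  simp only [Program.costBound, eval_add, eval_one, eval_X]
  omega

theorem Triple.ite (hR : ∀ s x, R s x → s.Bounded N) {b : Test} (β : Prop)
    (hb : ∀ s, R s x → (b.Holds s ↔ β)) (h : β → Triple V N R P x Q)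
    (h' : ¬ β → Triple V N R P' x Q) : Triple V N R (Program.ite b P P') x Q := by
  intro s hs
  have hc₀ := b.cost_le (hR s x hs)
  by_cases hβ : β
  · obtain ⟨c, s', hrun, hc, hq⟩ := h hβ s hs
    refine ⟨_, s', Runs.ite_true ((hb s hs).mpr hβ) hrun, ?_, hq⟩
    simp only [Program.costBound, eval_add, eval_one]
    omega
  · obtain ⟨c, s', hrun, hc, hq⟩ := h' hβ s hs
    refine ⟨_, s', Runs.ite_false (fun h => hβ ((hb s hs).mp h)) hrun, ?_, hq⟩
    simp only [Program.costBound, eval_add, eval_one]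
    omega

/-- A loop whose invariant `I` carries a bound `j ≤ N` for the number of remaining iterations. -/
theorem Triple.loop (hR : ∀ s x, R s x → s.Bounded N) {b : Test} (β : α → Prop) (I : ℕ → α → Prop)
    {j : ℕ} (hj : j ≤ N) (hI : I j x) (hb : ∀ s j x, I j x → R s x → (b.Holds s ↔ β x))
    (hbody : ∀ j x, I j x → β x → ∃ j', j = j' + 1 ∧ Triple V N R P x (I j'))
    (hexit : ∀ j x, I j x → ¬ β x → Q x) : Triple V N R (Program.loop b P) x Q := by
  -- The induction charges for `j` iterations; `j` is replaced by `N` only at the end.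
  have key : ∀ j x, I j x → ∀ s, R s x → ∃ c s', Runs V (Program.loop b P) s c s' ∧
      c ≤ j * (b.costBound.eval N + 1 + P.costBound.eval N) + (b.costBound.eval N + 1) ∧
      ∃ x', R s' x' ∧ Q x' := by
    intro j
    induction j with
    | zero =>
      intro x hI s hs
      have hβ : ¬ β x := fun h => by
        obtain ⟨j', hj', -⟩ := hbody 0 x hI h
        omega
      refine ⟨_, s, Runs.loop_false fun h => hβ ((hb s 0 x hI hs).mp h), ?_, x, hs,
        hexit 0 x hI hβ⟩
      have := b.cost_le (hR s x hs)
      omega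
    | succ j ih =>
      intro x hI s hs
      have hc₀ := b.cost_le (hR s x hs)
      by_cases hβ : β x
      · obtain ⟨j', hj', h⟩ := hbody _ x hI hβ
        obtain rfl : j = j' := by omega
        obtain ⟨c, s', hrun, hc, x', hx', hI'⟩ := h s hs
        obtain ⟨c', s'', hrun', hc', hq⟩ := ih x' hI' s' hx'
        refine ⟨_, s'', Runs.loop_true ((hb s _ x hI hs).mpr hβ) hrun hrun', ?_, hq⟩
        rw [add_mul, one_mul]
        omega
      · refine ⟨_, s, Runs.loop_false fun h => hβ ((hb s _ x hI hs).mp h), ?_, x, hs,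
          hexit _ x hI hβ⟩
        omega
  intro s hs
  obtain ⟨c, s', hrun, hc, hq⟩ := key j x hI s hs
  refine ⟨c, s', hrun, hc.trans ?_, hq⟩
  simp only [Program.costBound, eval_add, eval_mul, eval_X, eval_one]
  exact Nat.add_le_add_right (Nat.mul_le_mul_right _ hj) _

/-- `for c < e do P`, with the counter in cell `0` of index array `c`. -/
def Program.forLoop (c : ℕ) (e : IdxExpr) (P : Program) : Program :=
  .seq (.setIdx c (.const 0) (.const 0))
    (.loop (.not (.idxLe e (.load c (.const 0))))
      (.seq P (.setIdx c (.const 0) (.add (.load c (.const 0)) (.const 1)))))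

/-- The remaining number of iterations is `K - get y`, so the body has to leave the counter as it
found it. The maps `get` and `set` locate the counter in the abstract state. -/
theorem Triple.forLoop (hR : ∀ s x, R s x → s.Bounded N) {c K : ℕ} {e : IdxExpr} (hK : K ≤ N)
    (get : α → ℕ) (set : α → ℕ → α) (hgs : ∀ x y, get (set x y) = y)
    (he : ∀ s x, R s x → e.eval s = K) (hget : ∀ s x, R s x → s.idx c 0 = get x)
    (hset : ∀ s x y, R s x → y ≤ N → R (s.setIdx c 0 y) (set x y))
    (I : ℕ → α → Prop) (hI : I 0 (set x 0))
    (hbody : ∀ j y, j < K → get y = j → I j y →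
      Triple V N R P y fun z => get z = j ∧ I (j + 1) (set z (j + 1)))
    (hexit : ∀ y, get y = K → I K y → Q y) :
    Triple V N R (Program.forLoop c e P) x Q := by
  refine Triple.seq (Triple.setIdx hR (set x 0)
    (fun s hs => by simpa [IdxExpr.eval] using hset s x 0 hs (Nat.zero_le _)) ?_)
  refine Triple.loop hR (fun y => get y < K)
    (fun r y => get y ≤ K ∧ r = K - get y ∧ I (get y) y) (j := K) hK
    ⟨by simp [hgs], by simp [hgs], by simpa [hgs] using hI⟩ ?_ ?_ ?_
  · intro s j y _ hs
    simp [Test.Holds, IdxExpr.eval, he s y hs, hget s y hs]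
  · rintro r y ⟨hle, hr, hy⟩ hlt
    refine ⟨K - (get y + 1), by omega, Triple.seq ?_⟩
    refine (hbody (get y) y hlt rfl hy).mono fun z hz => ?_
    refine Triple.setIdx hR (set z (get y + 1)) (fun s hs => ?_) ?_
    · have h := hset s z (get y + 1) hs (by omega)
      simpa [IdxExpr.eval, hget s z hs, hz.1] using h
    · refine ⟨by rw [hgs]; omega, by rw [hgs], ?_⟩
      rw [hgs]
      exact hz.2
  · rintro r y ⟨hle, hr, hy⟩ hlt
    have hK' : get y = K := by omega
    exact hexit y hK' (hK' ▸ hy)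

end Triples

/-! ### Abstract states -/

/-- The contents of the memory, as seen by the allocation program: `v i` is the scale of the
thresholds of agent `i`, `k i` and `kk i` are the factors of its current threshold and of its
current threshold as long as it has not been served with a single item, `own` and `lock` are the
owners of the items and the set of items that must not be moved, `S` is the argument of the next
query, `q` holds the answers to recent queries, `i`, `b`, `j`, `cnt` are counters, and `moved` and
`fin` are flags. -/
structure Vars (n m : ℕ) where
  v : Fin n → ℚ
  q : ℕ → ℚ
  k : Fin n → ℕ
  kk : Fin n → ℕ
  own : Fin m → Fin n
  lock : Finset (Fin m)
  S : Finset (Fin m)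
  i : ℕ
  b : ℕ
  j : ℕ
  cnt : ℕ
  moved : ℕ
  fin : ℕ

variable {n m : ℕ}

/-- The threshold of an agent with scale `v` and factor `k`. -/
def threshold (n : ℕ) (v : ℚ) (k : ℕ) : ℚ := v * k / ((3 * n : ℕ) : ℚ)

/-- The current thresholds. -/
def Vars.thr (x : Vars n m) (i : Fin n) : ℚ := threshold n (x.v i) (x.kk i)

/-- The memory `s` represents the abstract state `x`. -/
structure Rep (N : ℕ) (s : Memory) (x : Vars n m) : Prop where
  bounded : s.Bounded N
  agents : s.idx 0 0 = n
  items : s.idx 0 1 = m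
  v : ∀ i (h : i < n), s.val 1 i = x.v ⟨i, h⟩
  q : ∀ c, s.val 0 c = x.q c
  k : ∀ i (h : i < n), s.idx 4 i = x.k ⟨i, h⟩
  kk : ∀ i (h : i < n), s.idx 5 i = x.kk ⟨i, h⟩
  own : ∀ b (h : b < m), s.idx 1 b = x.own ⟨b, h⟩
  lock : ∀ b (h : b < m), s.idx 3 b = 0 ↔ ⟨b, h⟩ ∉ x.lock
  S : ∀ b (h : b < m), s.idx 2 b = 0 ↔ ⟨b, h⟩ ∉ x.S
  i : s.idx 8 0 = x.i
  b : s.idx 9 0 = x.b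
  j : s.idx 10 0 = x.j
  cnt : s.idx 11 0 = x.cnt
  moved : s.idx 12 0 = x.moved
  fin : s.idx 13 0 = x.fin

namespace Memory

variable {N : ℕ} {s : Memory}

theorem Bounded.setIdx (h : s.Bounded N) (a i : ℕ) {y : ℕ} (hy : y ≤ N) :
    (s.setIdx a i y).Bounded N where
  idx_le a' i' := by
    simp only [Memory.setIdx, Function.update_apply]
    split_ifs
    · simp only [Function.update_apply]
      split_ifs
      exacts [hy, h.idx_le _ _]
    · exact h.idx_le _ _
  val_le := h.val_le

theorem Bounded.setVal (h : s.Bounded N) (a i : ℕ) {y : ℚ} (hy : ratBits y ≤ N) :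
    (s.setVal a i y).Bounded N where
  idx_le := h.idx_le
  val_le a' i' := by
    simp only [Memory.setVal, Function.update_apply]
    split_ifs
    · simp only [Function.update_apply]
      split_ifs
      exacts [hy, h.val_le _ _]
    · exact h.val_le _ _

theorem setIdx_same (s : Memory) (a i i' y : ℕ) :
    (s.setIdx a i y).idx a i' = if i' = i then y else s.idx a i' := by
  simp [Memory.setIdx, Function.update_apply]

theorem setVal_same (s : Memory) (a i i' : ℕ) (y : ℚ) :
    (s.setVal a i y).val a i' = if i' = i then y else s.val a i' := by
  simp [Memory.setVal, Function.update_apply]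

end Memory

namespace Rep

variable {N : ℕ} {s : Memory} {x : Vars n m}

theorem itemSet_eq (h : Rep N s x) : s.itemSet m 2 = x.S := by
  ext b
  simp [Memory.itemSet, h.S b b.2]

theorem agents_le (h : Rep N s x) : n ≤ N := h.agents ▸ h.bounded.idx_le 0 0

theorem items_le (h : Rep N s x) : m ≤ N := h.items ▸ h.bounded.idx_le 0 1

theorem ratBits_q_le (h : Rep N s x) (c : ℕ) : ratBits (x.q c) ≤ N :=
  h.q c ▸ h.bounded.val_le 0 c

theorem k_le (h : Rep N s x) (i : Fin n) : x.k i ≤ N :=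
  h.k i i.2 ▸ h.bounded.idx_le 4 i

/-- Array numbers are literals, so the arrays not written to reduce definitionally to the old ones,
and `h with` can reuse their fields. The other setters work alike. -/
theorem set_i (h : Rep N s x) {y : ℕ} (hy : y ≤ N) :
    Rep N (s.setIdx 8 0 y) { x with i := y } :=
  { h with bounded := h.bounded.setIdx _ _ hy, i := by simp [Memory.setIdx_same] }

theorem set_b (h : Rep N s x) {y : ℕ} (hy : y ≤ N) :
    Rep N (s.setIdx 9 0 y) { x with b := y } :=
  { h with bounded := h.bounded.setIdx _ _ hy, b := by simp [Memory.setIdx_same] }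

theorem set_j (h : Rep N s x) {y : ℕ} (hy : y ≤ N) :
    Rep N (s.setIdx 10 0 y) { x with j := y } :=
  { h with bounded := h.bounded.setIdx _ _ hy, j := by simp [Memory.setIdx_same] }

theorem set_cnt (h : Rep N s x) {y : ℕ} (hy : y ≤ N) :
    Rep N (s.setIdx 11 0 y) { x with cnt := y } :=
  { h with bounded := h.bounded.setIdx _ _ hy, cnt := by simp [Memory.setIdx_same] }

theorem set_moved (h : Rep N s x) {y : ℕ} (hy : y ≤ N) :
    Rep N (s.setIdx 12 0 y) { x with moved := y } :=
  { h with bounded := h.bounded.setIdx _ _ hy, moved := by simp [Memory.setIdx_same] }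

theorem set_fin (h : Rep N s x) {y : ℕ} (hy : y ≤ N) :
    Rep N (s.setIdx 13 0 y) { x with fin := y } :=
  { h with bounded := h.bounded.setIdx _ _ hy, fin := by simp [Memory.setIdx_same] }

theorem set_k (h : Rep N s x) (i : Fin n) {y : ℕ} (hy : y ≤ N) :
    Rep N (s.setIdx 4 i y) { x with k := Function.update x.k i y } :=
  { h with
    bounded := h.bounded.setIdx _ _ hy
    k := fun i' h' => by
      simp [Memory.setIdx_same, Function.update_apply, Fin.ext_iff, h.k i' h'] }

theorem set_kk (h : Rep N s x) (i : Fin n) {y : ℕ} (hy : y ≤ N) :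
    Rep N (s.setIdx 5 i y) { x with kk := Function.update x.kk i y } :=
  { h with
    bounded := h.bounded.setIdx _ _ hy
    kk := fun i' h' => by
      simp [Memory.setIdx_same, Function.update_apply, Fin.ext_iff, h.kk i' h'] }

theorem set_own (h : Rep N s x) (b : Fin m) (i : Fin n) :
    Rep N (s.setIdx 1 b i) { x with own := Function.update x.own b i } :=
  { h with
    bounded := h.bounded.setIdx _ _ (i.2.le.trans h.agents_le)
    own := fun b' h' => by
      simp only [Memory.setIdx_same, Function.update_apply, Fin.ext_iff, h.own b' h']
      split_ifs <;> rfl }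

theorem set_lock_zero (h : Rep N s x) (b : Fin m) :
    Rep N (s.setIdx 3 b 0) { x with lock := x.lock.erase b } :=
  { h with
    bounded := h.bounded.setIdx _ _ (Nat.zero_le _)
    lock := fun b' h' => by
      have := h.lock b' h'
      by_cases hb : b' = b <;> simp [Memory.setIdx_same, Fin.ext_iff, hb, this] }

theorem set_lock_one (h : Rep N s x) (b : Fin m) :
    Rep N (s.setIdx 3 b 1) { x with lock := insert b x.lock } :=
  { h with
    bounded := h.bounded.setIdx _ _ (by have := b.2; have := h.items_le; omega)
    lock := fun b' h' => by
      have := h.lock b' h'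
      by_cases hb : b' = b <;> simp [Memory.setIdx_same, Fin.ext_iff, hb, this] }

theorem set_S_zero (h : Rep N s x) (b : Fin m) :
    Rep N (s.setIdx 2 b 0) { x with S := x.S.erase b } :=
  { h with
    bounded := h.bounded.setIdx _ _ (Nat.zero_le _)
    S := fun b' h' => by
      have := h.S b' h'
      by_cases hb : b' = b <;> simp [Memory.setIdx_same, Fin.ext_iff, hb, this] }

theorem set_S_one (h : Rep N s x) (b : Fin m) :
    Rep N (s.setIdx 2 b 1) { x with S := insert b x.S } :=
  { h with
    bounded := h.bounded.setIdx _ _ (by have := b.2; have := h.items_le; omega)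
    S := fun b' h' => by
      have := h.S b' h'
      by_cases hb : b' = b <;> simp [Memory.setIdx_same, Fin.ext_iff, hb, this] }

theorem set_v (h : Rep N s x) (i : Fin n) {y : ℚ} (hy : ratBits y ≤ N) :
    Rep N (s.setVal 1 i y) { x with v := Function.update x.v i y } :=
  { h with
    bounded := h.bounded.setVal _ _ hy
    v := fun i' h' => by
      simp [Memory.setVal_same, Function.update_apply, Fin.ext_iff, h.v i' h'] }

theorem set_q (h : Rep N s x) (c : ℕ) {y : ℚ} (hy : ratBits y ≤ N) :
    Rep N (s.setVal 0 c y) { x with q := Function.update x.q c y } :=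
  { h with
    bounded := h.bounded.setVal _ _ hy
    q := fun c' => by simp [Memory.setVal_same, Function.update_apply, h.q c'] }

end Rep

/-! ### The program -/

namespace Algo

open Program IdxExpr

def nAgents : IdxExpr := load 0 (const 0)
def nItems : IdxExpr := load 0 (const 1)
def agent : IdxExpr := load 8 (const 0)
def item : IdxExpr := load 9 (const 0)
def scan : IdxExpr := load 10 (const 0)
def count : IdxExpr := load 11 (const 0)
def answer (c : ℕ) : ValExpr := .load 0 (const c)

/-- The current threshold of agent `e`. -/
def thr (e : IdxExpr) : ValExpr :=
  .div (.mul (.load 1 e) (.ofIdx (load 5 e))) (.ofIdx (mul (const 3) nAgents))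

def forAgents (P : Program) : Program := forLoop 8 nAgents P
def forItems (P : Program) : Program := forLoop 9 nItems P
def forScan (P : Program) : Program := forLoop 10 nItems P

/-- Ask agent `e` for the value of the current set. -/
def ask (c : ℕ) (e : IdxExpr) : Program := query 0 (const c) e 2

/-- Ask the current agent for the value of the item `e`. -/
def askSingle (c : ℕ) (e : IdxExpr) : Program :=
  seq (setIdx 2 e (const 1)) (seq (ask c agent) (setIdx 2 e (const 0)))

/-- Make the bundle of agent `e` the current set. -/
def fill (e : IdxExpr) : Program :=
  -- With truncated subtraction this is `1` if the owner equals `e` and `0` otherwise.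
  forScan (setIdx 2 scan (sub (sub (const 1) (sub (load 1 scan) e)) (sub e (load 1 scan))))

/-- Compute the scales and the initial factors of the thresholds. -/
def init : Program :=
  forAgents (seq (query 1 agent agent 2)
    (seq (setIdx 4 agent (mul (mul (const 3) nAgents) (add nItems (const 1))))
      (forItems (seq (askSingle 0 item) (seq (setIdx 11 (const 0) (const 0))
        (seq
          (forScan (seq (askSingle 1 scan)
            (ite (.valLe (answer 0) (answer 1))
              (setIdx 11 (const 0) (add count (const 1))) skip)))
          (ite (.and (.idxLe nAgents count) (.valLe (.load 1 agent) (answer 0)))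
            (setVal 1 agent (answer 0)) skip)))))))

/-- Start a round: all items are unlocked and belong to agent `0`. -/
def reset : Program :=
  seq (setIdx 13 (const 0) (const 1))
    (seq (forAgents (setIdx 5 agent (load 4 agent)))
      (forItems (seq (setIdx 3 item (const 0))
        (seq (setIdx 1 item (const 0)) (setIdx 2 item (const 0))))))

/-- Serve agents with single items that reach a third of their thresholds. -/
def lockPass : Program :=
  forAgents (forItems (seq (askSingle 0 item)
    (ite (.and (.idxLe (const 1) (load 5 agent)) (.and (.idxLe (load 3 item) (const 0))
        (.valLe (thr agent) (.mul (.const 3) (answer 0)))))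
      (seq (setIdx 1 item agent) (seq (setIdx 3 item (const 1)) (setIdx 5 agent (const 0))))
      skip)))

/-- The test whether the current move is improving. -/
def improving : Test :=
  let gain : ValExpr := .sub (.sub (.div (answer 1) (thr agent)) (.div (answer 0) (thr agent)))
    (.div (.const 1) (.ofIdx (mul (const 3) nItems)))
  let old : ValExpr := .div (answer 2) (thr (load 1 item))
  let new : ValExpr := .div (answer 3) (thr (load 1 item))
  let cap : ValExpr := .const (2 / 3)
  .and (.and (.idxLe (load 3 item) (const 0))
      (.not (.valLe (thr agent) (.mul (.const 3) (answer 0)))))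
    (.and (.not (.and (.valLe (.add gain new) old) (.valLe (.add gain new) cap)))
      (.not (.and (.valLe (.add gain cap) old) (.valLe (.add gain cap) cap))))

/-- Give the current item to the current agent if that is improving. -/
def step : Program :=
  seq (fill agent) (seq (ask 0 agent) (seq (setIdx 2 item (const 1)) (seq (ask 1 agent)
    (seq (fill (load 1 item)) (seq (ask 2 (load 1 item)) (seq (setIdx 2 item (const 0))
      (seq (ask 3 (load 1 item))
        (ite improving (seq (setIdx 1 item agent) (setIdx 12 (const 0) (const 1))) skip))))))))

/-- The local search. -/
def search : Program :=
  seq (setIdx 12 (const 0) (const 1))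
    (loop (.idxLe (const 1) (load 12 (const 0)))
      (seq (setIdx 12 (const 0) (const 0)) (forAgents (forItems step))))

/-- Lower the thresholds of the agents that are below a third of their thresholds. -/
def update : Program :=
  forAgents (seq (fill agent) (seq (ask 0 agent)
    (ite (.not (.valLe (thr agent) (.mul (.const 3) (answer 0))))
      (seq (setIdx 4 agent (sub (load 4 agent) (const 1))) (setIdx 13 (const 0) (const 0)))
      skip)))

/-- The allocation program. -/
def main : Program :=
  seq init (loop (.idxLe (load 13 (const 0)) (const 0))
    (seq reset (seq lockPass (seq search update))))

end Algo

/-! ### Rules for the building blocks -/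

section Blocks

variable {V : Fin n → Finset (Fin m) → ℚ} {N : ℕ} {x : Vars n m} {Q : Vars n m → Prop}
  {P : Program}

theorem rep_bounded : ∀ s (x : Vars n m), Rep N s x → s.Bounded N := fun _ _ h => h.bounded

theorem valueOracle_fin (i : Fin n) (S : Finset (Fin m)) : valueOracle V i S = V i S := by
  simp [valueOracle]

theorem triple_forAgents (hn : n ≤ N) (I : ℕ → Vars n m → Prop) (hI : I 0 { x with i := 0 })
    (hbody : ∀ (i : Fin n) (y : Vars n m), y.i = i → I i y →
      Triple V N (Rep N) P y fun z => z.i = i ∧ I (i + 1) { z with i := i + 1 })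
    (hexit : ∀ y : Vars n m, I n y → Q y) : Triple V N (Rep N) (Algo.forAgents P) x Q :=
  Triple.forLoop rep_bounded hn (fun y => y.i) (fun y i => { y with i := i }) (fun _ _ => rfl)
    (fun s x h => by simpa [Algo.nAgents, IdxExpr.eval] using h.agents)
    (fun s x h => h.i) (fun s x y h hy => h.set_i hy) I hI
    (fun i y hi hy hIy => hbody ⟨i, hi⟩ y hy hIy) fun y _ hy => hexit y hy

theorem triple_forItems (hm : m ≤ N) (I : ℕ → Vars n m → Prop) (hI : I 0 { x with b := 0 })
    (hbody : ∀ (b : Fin m) (y : Vars n m), y.b = b → I b y →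
      Triple V N (Rep N) P y fun z => z.b = b ∧ I (b + 1) { z with b := b + 1 })
    (hexit : ∀ y : Vars n m, I m y → Q y) : Triple V N (Rep N) (Algo.forItems P) x Q :=
  Triple.forLoop rep_bounded hm (fun y => y.b) (fun y b => { y with b := b }) (fun _ _ => rfl)
    (fun s x h => by simpa [Algo.nItems, IdxExpr.eval] using h.items)
    (fun s x h => h.b) (fun s x y h hy => h.set_b hy) I hI
    (fun b y hb hy hIy => hbody ⟨b, hb⟩ y hy hIy) fun y _ hy => hexit y hy

theorem triple_forScan (hm : m ≤ N) (I : ℕ → Vars n m → Prop) (hI : I 0 { x with j := 0 })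
    (hbody : ∀ (b : Fin m) (y : Vars n m), y.j = b → I b y →
      Triple V N (Rep N) P y fun z => z.j = b ∧ I (b + 1) { z with j := b + 1 })
    (hexit : ∀ y : Vars n m, y.j = m → I m y → Q y) :
    Triple V N (Rep N) (Algo.forScan P) x Q :=
  Triple.forLoop rep_bounded hm (fun y => y.j) (fun y b => { y with j := b }) (fun _ _ => rfl)
    (fun s x h => by simpa [Algo.nItems, IdxExpr.eval] using h.items)
    (fun s x h => h.j) (fun s x y h hy => h.set_j hy) I hI
    (fun b y hb hy hIy => hbody ⟨b, hb⟩ y hy hIy) hexit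

theorem triple_ask (hN : ∀ k S, ratBits (valueOracle V k S) ≤ N) {c : ℕ} {e : IdxExpr}
    (i : Fin n) (he : ∀ s, Rep N s x → e.eval s = i)
    (hQ : Q { x with q := Function.update x.q c (V i x.S) }) :
    Triple V N (Rep N) (Algo.ask c e) x Q := by
  refine Triple.query rep_bounded hN _ (fun s hs => ?_) hQ
  rw [he s hs, hs.itemSet_eq, valueOracle_fin]
  exact hs.set_q c (valueOracle_fin (V := V) i x.S ▸ hN i x.S)

/-- The current set must be empty before, and is empty again afterwards. The index expression is
evaluated again after the query, hence `he` for all values of `S` and `q`. -/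
theorem triple_askSingle (hN : ∀ k S, ratBits (valueOracle V k S) ≤ N) {c : ℕ} {e : IdxExpr}
    (i : Fin n) (b : Fin m) (hi : x.i = i)
    (he : ∀ s S q, Rep N s { x with S := S, q := q } → e.eval s = b) (hS : x.S = ∅)
    (hQ : Q { x with q := Function.update x.q c (V i {b}) }) :
    Triple V N (Rep N) (Algo.askSingle c e) x Q := by
  refine Triple.seq (Triple.setIdx rep_bounded { x with S := {b} } (fun s hs => ?_) ?_)
  · have h := hs.set_S_one b
    rw [hS, insert_empty_eq] at h
    simpa [IdxExpr.eval, he s x.S x.q hs] using h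
  refine Triple.seq (triple_ask hN i (fun s hs => ?_) ?_)
  · simpa [Algo.agent, IdxExpr.eval, hi] using hs.i
  refine Triple.setIdx rep_bounded _ (fun s hs => ?_) hQ
  have h := hs.set_S_zero b
  simp only [Finset.erase_singleton] at h
  simp only [IdxExpr.eval, he s _ _ hs]
  convert h using 2

/-- Every cell of the current set is overwritten, so nothing is assumed about its old contents; the
invariant concerns only the items already scanned. -/
theorem triple_fill (hm : m ≤ N) {e : IdxExpr} (i : Fin n)
    (he : ∀ s S j, Rep N s { x with S := S, j := j } → e.eval s = i)
    (hQ : Q { x with S := bundle x.own i, j := m }) :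
    Triple V N (Rep N) (Algo.fill e) x Q := by
  refine triple_forScan hm (fun j y => ∃ S, y = { x with S := S, j := j } ∧
    ∀ b : Fin m, (b : ℕ) < j → (b ∈ S ↔ x.own b = i)) ⟨x.S, rfl, by simp⟩ ?_ ?_
  · rintro b y - ⟨S, rfl, hS⟩
    refine Triple.setIdx rep_bounded
      { x with S := if x.own b = i then insert b S else S.erase b, j := b } (fun s hs => ?_)
      ⟨rfl, _, rfl, fun c hc => ?_⟩
    · have h₁ := hs.set_S_one b
      have h₀ := hs.set_S_zero b
      have hscan : Algo.scan.eval s = b := by simpa [Algo.scan, IdxExpr.eval] using hs.j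
      have hown := hs.own b b.2
      simp only [IdxExpr.eval, hscan, he s _ _ hs, hown]
      by_cases hb : x.own b = i
      · simpa [hb] using h₁
      · have h : 1 - ((x.own b : ℕ) - i) - (i - x.own b) = 0 := by
          have := fun h => hb (Fin.ext h)
          omega
        simpa [hb, h] using h₀
    · by_cases hcb : c = b
      · subst hcb
        split_ifs with hb <;> simp [hb]
      · have hc' : (c : ℕ) < b := by
          have := fun h => hcb (Fin.ext h)
          omega
        split_ifs <;> simp [hcb, hS c hc']
  · rintro y - ⟨S, rfl, hS⟩
    have : S = bundle x.own i := by
      ext b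
      rw [hS b b.2, mem_bundle]
    exact this ▸ hQ

theorem Rep.eval_thr {s : Memory} (h : Rep N s x) {e : IdxExpr} {i : Fin n} (he : e.eval s = i) :
    (Algo.thr e).eval s = x.thr i := by
  simp [Algo.thr, Algo.nAgents, ValExpr.eval, IdxExpr.eval, he, h.v i i.2, h.kk i i.2, h.agents,
    Vars.thr, threshold]

theorem Rep.eval_answer {s : Memory} (h : Rep N s x) (c : ℕ) :
    (Algo.answer c).eval s = x.q c := by
  simp [Algo.answer, ValExpr.eval, IdxExpr.eval, h.q]

theorem Rep.eval_agent {s : Memory} (h : Rep N s x) : Algo.agent.eval s = x.i := h.i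

theorem Rep.eval_item {s : Memory} (h : Rep N s x) : Algo.item.eval s = x.b := h.b

theorem Rep.eval_scan {s : Memory} (h : Rep N s x) : Algo.scan.eval s = x.j := h.j

end Blocks

variable {V : Fin n → Finset (Fin m) → ℚ} {N : ℕ} {x : Vars n m}
  {Q : Vars n m → Prop}

/-! ### Initialization -/

/-- The number of items among the first `j` that are worth at least `q`. -/
def countGe (f : Finset (Fin m) → ℚ) (q : ℚ) (j : ℕ) : ℕ :=
  (Finset.univ.filter fun c : Fin m => (c : ℕ) < j ∧ q ≤ f {c}).card

theorem countGe_succ (f : Finset (Fin m) → ℚ) (q : ℚ) (b : Fin m) :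
    countGe f q (b + 1) = countGe f q b + if q ≤ f {b} then 1 else 0 := by
  have h : (Finset.univ.filter fun c : Fin m => (c : ℕ) < b + 1 ∧ q ≤ f {c}) =
      (Finset.univ.filter fun c : Fin m => (c : ℕ) < b ∧ q ≤ f {c}) ∪
        if q ≤ f {b} then {b} else ∅ := by
    ext c
    have hlt : (c : ℕ) < b + 1 ↔ (c : ℕ) < b ∨ c = b := by
      rw [Fin.ext_iff]; omega
    by_cases hb : q ≤ f {b}
    · simp only [Finset.mem_filter, Finset.mem_univ, true_and, hlt, hb, if_true,
        Finset.mem_union, Finset.mem_singleton]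
      constructor
      · rintro ⟨h | h, h'⟩
        exacts [Or.inl ⟨h, h'⟩, Or.inr h]
      · rintro (h | rfl)
        exacts [⟨Or.inl h.1, h.2⟩, ⟨Or.inr rfl, hb⟩]
    · simp only [Finset.mem_filter, Finset.mem_univ, true_and, hlt, hb, if_false,
        Finset.union_empty]
      constructor
      · rintro ⟨h | rfl, h'⟩
        exacts [⟨h, h'⟩, absurd h' hb]
      · exact fun h => ⟨Or.inl h.1, h.2⟩
  rw [countGe, h, Finset.card_union_of_disjoint, countGe]
  · split_ifs <;> simp
  · split_ifs <;> simp

theorem countGe_le (f : Finset (Fin m) → ℚ) (q : ℚ) (j : ℕ) : countGe f q j ≤ m :=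
  (Finset.card_le_univ _).trans (Fintype.card_fin m).le

theorem countGe_all (f : Finset (Fin m) → ℚ) (q : ℚ) :
    countGe f q m = (Finset.univ.filter fun c => q ≤ f {c}).card := by
  simp [countGe]

/-- `v` is the right scale if only the first `b` items are taken into account. -/
structure IsPartialNthValue (n : ℕ) (f : Finset (Fin m) → ℚ) (b : ℕ) (v : ℚ) : Prop where
  empty_le : f ∅ ≤ v
  single_le : ∀ c : Fin m, (c : ℕ) < b → n ≤ countGe f (f {c}) m → f {c} ≤ v
  attained : v = f ∅ ∨ ∃ c, v = f {c} ∧ n ≤ countGe f (f {c}) m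

theorem IsPartialNthValue.isNthValue {f : Finset (Fin m) → ℚ} {v : ℚ}
    (h : IsPartialNthValue n f m v) : IsNthValue n f v where
  empty_le := h.empty_le
  single_le c hc := h.single_le c c.2 (by rwa [countGe_all])
  attained := h.attained.imp_right fun ⟨c, hc, hn⟩ => ⟨c, hc, by rwa [countGe_all] at hn⟩

/-- The `n`-th largest value is the maximum of the values reached by at least `n` items. Only the
candidates are restricted to the first `b` items while the count runs over all, so a running maximum
suffices. -/
theorem IsPartialNthValue.succ {f : Finset (Fin m) → ℚ} {v : ℚ} {b : Fin m}
    (h : IsPartialNthValue n f b v) :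
    IsPartialNthValue n f (b + 1)
      (if n ≤ countGe f (f {b}) m ∧ v ≤ f {b} then f {b} else v) := by
  have hv : v ≤ if n ≤ countGe f (f {b}) m ∧ v ≤ f {b} then f {b} else v := by
    split_ifs with hb
    exacts [hb.2, le_rfl]
  refine ⟨h.empty_le.trans hv, fun c hc hn => ?_, ?_⟩
  · by_cases hcb : c = b
    · subst hcb
      split_ifs with hb
      · exact le_rfl
      · exact (not_le.mp fun h' => hb ⟨hn, h'⟩).le
    · have : (c : ℕ) < b := by
        have := fun h => hcb (Fin.ext h)
        omega
      exact (h.single_le c this hn).trans hv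
  · split_ifs with hb
    exacts [Or.inr ⟨b, rfl, hb.1⟩, h.attained]

theorem triple_init (hN : ∀ k S, ratBits (valueOracle V k S) ≤ N) (hn : n ≤ N) (hm : m ≤ N)
    (hk : 3 * n * (m + 1) ≤ N) (hS : x.S = ∅)
    (hQ : ∀ y : Vars n m, y.fin = x.fin → (∀ i, IsNthValue n (V i) (y.v i)) →
      (∀ i, y.k i = 3 * n * (m + 1)) → Q y) :
    Triple V N (Rep N) Algo.init x Q := by
  refine triple_forAgents hn (fun i y => y.fin = x.fin ∧ y.S = ∅ ∧
    ∀ i' : Fin n, (i' : ℕ) < i → IsNthValue n (V i') (y.v i') ∧ y.k i' = 3 * n * (m + 1))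
    ⟨rfl, hS, by simp⟩ ?_
    (fun y hy => hQ y hy.1 (fun i => (hy.2.2 i i.2).1) fun i => (hy.2.2 i i.2).2)
  rintro i y hyi ⟨hfin, hyS, hy⟩
  refine Triple.seq (Triple.query rep_bounded hN
    { y with v := Function.update y.v i (V i ∅) } (fun s hs => ?_) ?_)
  · rw [hs.eval_agent.trans hyi, hs.itemSet_eq.trans hyS, valueOracle_fin]
    exact hs.set_v i (valueOracle_fin (V := V) i ∅ ▸ hN i ∅)
  refine Triple.seq (Triple.setIdx rep_bounded
    { y with
      v := Function.update y.v i (V i ∅)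
      k := Function.update y.k i (3 * n * (m + 1)) } (fun s hs => ?_) ?_)
  · have h := hs.set_k i hk
    simpa [hs.eval_agent, hyi, Algo.nAgents, Algo.nItems, IdxExpr.eval, hs.agents, hs.items]
      using h
  refine triple_forItems hm (fun b z => z.i = i ∧ z.fin = x.fin ∧ z.S = ∅ ∧
    z.k = Function.update y.k i (3 * n * (m + 1)) ∧ (∀ i', i' ≠ i → z.v i' = y.v i') ∧
    IsPartialNthValue n (V i) b (z.v i)) ?_ ?_ ?_
  · refine ⟨hyi, hfin, hyS, rfl, fun i' hi' => by simp [hi'], ?_⟩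
    simp only [Function.update_self]
    exact ⟨le_rfl, by simp, Or.inl rfl⟩
  · rintro b z hzb ⟨hzi, hzfin, hzS, hzk, hzv, hpart⟩
    refine Triple.seq (triple_askSingle hN i b hzi (fun s S q hs => hs.eval_item.trans hzb) hzS ?_)
    refine Triple.seq (Triple.setIdx rep_bounded _ (fun s hs => hs.set_cnt (Nat.zero_le _)) ?_)
    refine Triple.seq (triple_forScan hm (fun j w => w.i = i ∧ w.b = b ∧ w.fin = x.fin ∧
      w.S = ∅ ∧ w.k = z.k ∧ w.v = z.v ∧ w.q 0 = V i {b} ∧ w.cnt = countGe (V i) (V i {b}) j)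
      ⟨hzi, hzb, hzfin, hzS, rfl, rfl, by simp, by simp [countGe]⟩ ?_ ?_)
    · rintro c w hwj ⟨hwi, hwb, hwfin, hwS, hwk, hwv, hwq, hwc⟩
      refine Triple.seq (triple_askSingle hN i c hwi (fun s S q hs => hs.eval_scan.trans hwj)
        hwS ?_)
      have hq : Function.update w.q 1 (V i {c}) 0 = V i {b} := by simp [hwq]
      refine Triple.ite rep_bounded (V i {b} ≤ V i {c}) (fun s hs => ?_) (fun hle => ?_)
        (fun hle => ?_)
      · simp only [Test.Holds, hs.eval_answer, hq, Function.update_self]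
      · refine Triple.setIdx rep_bounded
          { w with q := Function.update w.q 1 (V i {c}), cnt := w.cnt + 1 } (fun s hs => ?_)
          ⟨hwj, hwi, hwb, hwfin, hwS, hwk, hwv, hq, ?_⟩
        -- The counter respects the memory bound because it never exceeds `m`.
        · have h := hs.set_cnt (y := w.cnt + 1) (by
            have := countGe_succ (V i) (V i {b}) c
            have := countGe_le (V i) (V i {b}) (c + 1)
            simp only [hle, if_true] at *
            omega)
          simpa [IdxExpr.eval, Algo.count, hs.cnt] using h
        · simp [countGe_succ, hle, hwc]
      · exact Triple.skip ⟨hwj, hwi, hwb, hwfin, hwS, hwk, hwv, hq,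
          by simp [countGe_succ, hle, hwc]⟩
    · rintro w - ⟨hwi, hwb, hwfin, hwS, hwk, hwv, hwq, hwc⟩
      have hnext := hpart.succ
      refine Triple.ite rep_bounded (n ≤ countGe (V i) (V i {b}) m ∧ z.v i ≤ V i {b})
        (fun s hs => ?_) (fun hle => ?_) (fun hle => ?_)
      · simp [Test.Holds, hs.eval_answer, ValExpr.eval, hs.eval_agent, hwi, hs.v i i.2,
          Algo.nAgents, Algo.count, IdxExpr.eval, hs.agents, hs.cnt, hwq, hwc, hwv]
      · rw [if_pos hle] at hnext
        refine Triple.setVal rep_bounded { w with v := Function.update w.v i (V i {b}) }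
          (fun s hs => ?_) ⟨hwb, hwi, hwfin, hwS, hwk.trans hzk, fun i' hi' => ?_, ?_⟩
        · rw [hs.eval_answer, hs.eval_agent.trans hwi, hwq]
          exact hs.set_v i (hwq ▸ hs.ratBits_q_le 0)
        · simp [hi', hwv, hzv i' hi']
        · simpa using hnext
      · rw [if_neg hle] at hnext
        exact Triple.skip ⟨hwb, hwi, hwfin, hwS, hwk.trans hzk,
          fun i' hi' => by simp [hwv, hzv i' hi'], by simpa [hwv] using hnext⟩
  · rintro z ⟨hzi, hzfin, hzS, hzk, hzv, hpart⟩
    refine ⟨hzi, hzfin, hzS, fun i' hi' => ?_⟩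
    by_cases h : i' = i
    · subst h
      exact ⟨hpart.isNthValue, by simp [hzk]⟩
    · have : (i' : ℕ) < i := by
        have := fun h' => h (Fin.ext h')
        omega
      simpa [hzv i' h, hzk, h] using hy i' this

/-! ### Start of a round -/

theorem triple_reset [NeZero n] (hn : n ≤ N) (hm : m ≤ N)
    (hQ : ∀ y : Vars n m, y.v = x.v → y.k = x.k → y.kk = x.k → y.lock = ∅ → y.S = ∅ →
      y.fin = 1 → Q y) :
    Triple V N (Rep N) Algo.reset x Q := by
  have hnpos := Nat.pos_of_neZero n
  refine Triple.seq (Triple.setIdx rep_bounded { x with fin := 1 }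
    (fun s hs => hs.set_fin (hnpos.trans_le hn)) ?_)
  refine Triple.seq (triple_forAgents hn (fun i y => y.v = x.v ∧ y.k = x.k ∧ y.fin = 1 ∧
    ∀ i' : Fin n, (i' : ℕ) < i → y.kk i' = x.k i') ⟨rfl, rfl, rfl, by simp⟩ ?_ ?_)
  · rintro i y hyi ⟨hv, hk, hfin, hkk⟩
    refine Triple.setIdx rep_bounded { y with kk := Function.update y.kk i (y.k i) }
      (fun s hs => ?_) ⟨hyi, hv, hk, hfin, fun i' hi' => ?_⟩
    · have h := hs.set_kk i (hs.k_le i)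
      simpa [IdxExpr.eval, hs.eval_agent, hyi, hs.k i i.2] using h
    · by_cases h : i' = i
      · simp [h, hk]
      · have : (i' : ℕ) < i := by
          have := fun h' => h (Fin.ext h')
          omega
        simp [h, hkk i' this]
  · rintro y ⟨hv, hk, hfin, hkk⟩
    refine triple_forItems hm (fun b z => z.v = x.v ∧ z.k = x.k ∧ z.kk = x.k ∧ z.fin = 1 ∧
      ∀ c : Fin m, (c : ℕ) < b → c ∉ z.lock ∧ c ∉ z.S)
      ⟨hv, hk, funext fun i => hkk i i.2, hfin, by simp⟩ ?_ ?_
    · rintro b z hzb ⟨hv, hk, hkk, hfin, hz⟩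
      refine Triple.seq (Triple.setIdx rep_bounded { z with lock := z.lock.erase b }
        (fun s hs => ?_) ?_)
      · rw [hs.eval_item.trans hzb]
        exact hs.set_lock_zero b
      refine Triple.seq (Triple.setIdx rep_bounded
        { z with lock := z.lock.erase b, own := Function.update z.own b 0 } (fun s hs => ?_) ?_)
      · rw [hs.eval_item]
        simpa [hzb, IdxExpr.eval] using hs.set_own b 0
      refine Triple.setIdx rep_bounded
        { z with
          lock := z.lock.erase b
          own := Function.update z.own b 0
          S := z.S.erase b } (fun s hs => ?_) ⟨hzb, hv, hk, hkk, hfin, fun c hc => ?_⟩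
      · rw [hs.eval_item]
        simpa [hzb, IdxExpr.eval] using hs.set_S_zero b
      · by_cases h : c = b
        · simp [h]
        · have : (c : ℕ) < b := by
            have := fun h' => h (Fin.ext h')
            omega
          simp [hz c this]
    · rintro z ⟨hv, hk, hkk, hfin, hz⟩
      exact hQ z hv hk hkk (Finset.eq_empty_of_forall_notMem fun c => (hz c c.2).1)
        (Finset.eq_empty_of_forall_notMem fun c => (hz c c.2).2) hfin

/-! ### Single items -/

/-- Every agent still has its factor `k i`, or it owns a locked item that is worth a third of its
threshold. -/
def Served (V : Fin n → Finset (Fin m) → ℚ) (v : Fin n → ℚ) (k kk : Fin n → ℕ)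
    (lock : Finset (Fin m)) (own : Fin m → Fin n) : Prop :=
  ∀ i, kk i = k i ∨ kk i = 0 ∧
    ∃ b ∈ lock, own b = i ∧ threshold n (v i) (k i) ≤ 3 * V i {b}

theorem triple_lockPass (hN : ∀ k S, ratBits (valueOracle V k S) ≤ N) (hn : n ≤ N) (hm : m ≤ N)
    (hkk : x.kk = x.k) (hlock : x.lock = ∅) (hS : x.S = ∅)
    (hQ : ∀ y : Vars n m, y.v = x.v → y.k = x.k → y.fin = x.fin →
      Served V y.v y.k y.kk y.lock y.own →
      y.lock.card ≤ (Finset.univ.filter fun i => y.kk i = 0).card →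
      (∀ i b, y.kk i ≠ 0 → b ∉ y.lock → 3 * V i {b} < y.thr i) → Q y) :
    Triple V N (Rep N) Algo.lockPass x Q := by
  -- `D` marks the pairs already examined. Later steps only enlarge the lock and set factors to `0`,
  -- so what holds for these pairs persists. Each locked item retires one agent with non-zero
  -- factor, which preserves the inequality of cardinalities.
  let Inv : (Fin n → Fin m → Prop) → Vars n m → Prop := fun D y =>
    y.v = x.v ∧ y.k = x.k ∧ y.fin = x.fin ∧ y.S = ∅ ∧ Served V y.v y.k y.kk y.lock y.own ∧
      y.lock.card ≤ (Finset.univ.filter fun i => y.kk i = 0).card ∧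
      ∀ i b, D i b → y.kk i ≠ 0 → b ∉ y.lock → 3 * V i {b} < y.thr i
  refine triple_forAgents hn (fun i y => Inv (fun i' _ => (i' : ℕ) < i) y) ?_ ?_ ?_
  · exact ⟨rfl, rfl, rfl, hS, fun i => Or.inl (by rw [hkk]), by simp [hlock], by simp⟩
  · rintro i y hyi hy
    refine triple_forItems hm (fun b z => z.i = i ∧
      Inv (fun i' b' => (i' : ℕ) < i ∨ i' = i ∧ (b' : ℕ) < b) z) ⟨hyi, by simpa [Inv, Vars.thr] using hy⟩
      ?_ ?_
    · rintro b z hzb ⟨hzi, hv, hk, hfin, hzS, hserved, hcard, hdone⟩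
      refine Triple.seq (triple_askSingle hN i b hzi (fun s S q hs => hs.eval_item.trans hzb)
        hzS ?_)
      refine Triple.ite rep_bounded (z.kk i ≠ 0 ∧ b ∉ z.lock ∧ z.thr i ≤ 3 * V i {b})
        (fun s hs => ?_) ?_ (fun hnot => ?_)
      · have h₁ : Algo.agent.eval s = i := hs.eval_agent.trans hzi
        have h₂ : Algo.item.eval s = b := hs.eval_item.trans hzb
        have h₃ := hs.lock b b.2
        simp only [Test.Holds, ValExpr.eval, IdxExpr.eval, hs.eval_answer, hs.eval_thr h₁, h₁, h₂,
          hs.kk i i.2, Function.update_self, Nat.one_le_iff_ne_zero, Nat.le_zero, h₃]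
        rfl
      · rintro ⟨hki, hb, hthr⟩
        have hki' : z.kk i = z.k i := (hserved i).resolve_right fun h => hki h.1
        refine Triple.seq (Triple.setIdx rep_bounded
          { z with
            q := Function.update z.q 0 (V i {b})
            own := Function.update z.own b i } (fun s hs => ?_) ?_)
        · rw [hs.eval_item, hs.eval_agent]
          simpa [hzb, hzi] using hs.set_own b i
        refine Triple.seq (Triple.setIdx rep_bounded
          { z with
            q := Function.update z.q 0 (V i {b})
            own := Function.update z.own b i
            lock := insert b z.lock } (fun s hs => ?_) ?_)
        · rw [hs.eval_item]
          simpa [hzb, IdxExpr.eval] using hs.set_lock_one b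
        refine Triple.setIdx rep_bounded
          { z with
            q := Function.update z.q 0 (V i {b})
            own := Function.update z.own b i
            lock := insert b z.lock
            kk := Function.update z.kk i 0 } (fun s hs => ?_)
          ⟨hzb, hzi, hv, hk, hfin, hzS, fun i' => ?_, ?_, fun i' b' hD hk' hb' => ?_⟩
        · rw [hs.eval_agent]
          simpa [hzi, IdxExpr.eval] using hs.set_kk i (Nat.zero_le _)
        · by_cases hi' : i' = i
          · subst hi'
            refine Or.inr ⟨by simp, b, by simp, by simp, ?_⟩
            rw [← hki']
            exact hthr
          · rcases hserved i' with h | ⟨h, c, hc, hown, hle⟩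
            · exact Or.inl (by simpa [hi'] using h)
            · have hcb : c ≠ b := fun h => hb (h ▸ hc)
              exact Or.inr ⟨by simpa [hi'] using h, c, by simp [hc], by simpa [hcb] using hown, hle⟩
        · have h : (Finset.univ.filter fun i' => Function.update z.kk i 0 i' = 0) =
              insert i (Finset.univ.filter fun i' => z.kk i' = 0) := by
            ext i'
            by_cases hi' : i' = i <;> simp [hi']
          rw [Finset.card_insert_of_notMem hb, h, Finset.card_insert_of_notMem (by simpa using hki)]
          omega
        · by_cases hi' : i' = i
          · exact absurd (by simp [hi']) hk'
          · have hkk' : Function.update z.kk i 0 i' = z.kk i' := by simp [hi']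
            have h := hdone i' b' (hD.imp_right fun h => absurd h.1 hi') (by simpa [hi'] using hk')
              fun h => hb' (Finset.mem_insert_of_mem h)
            simpa [Vars.thr, hkk'] using h
      · refine Triple.skip ⟨hzb, hzi, hv, hk, hfin, hzS, hserved, hcard,
          fun i' b' hD hk' hb' => ?_⟩
        by_cases h : i' = i ∧ b' = b
        · obtain ⟨rfl, rfl⟩ := h
          exact not_le.mp fun hle => hnot ⟨hk', hb', hle⟩
        · refine hdone i' b' (hD.imp_right fun h' => ⟨h'.1, ?_⟩) hk' hb'
          have := fun e => h ⟨h'.1, Fin.ext e⟩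
          have := h'.2
          omega
    · rintro z ⟨hzi, hv, hk, hfin, hzS, hserved, hcard, hdone⟩
      refine ⟨hzi, hv, hk, hfin, hzS, hserved, hcard, fun i' b' hD hk' hb' => ?_⟩
      refine hdone i' b' ?_ hk' hb'
      by_cases h : i' = i
      · exact Or.inr ⟨h, b'.2⟩
      · have := fun h' => h (Fin.ext h')
        exact Or.inl (by omega)
  · rintro y ⟨hv, hk, hfin, -, hserved, hcard, hdone⟩
    exact hQ y hv hk hfin hserved hcard fun i b => hdone i b i.2

/-! ### Local search -/

/-- Expressions have no minimum, so the capped comparison is unfolded into the tests that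
`Algo.improving` makes. -/
theorem min_lt_add_min_iff {a b c g : ℚ} : min a c < g + min b c ↔
    ¬ (g + b ≤ a ∧ g + b ≤ c) ∧ ¬ (g + c ≤ a ∧ g + c ≤ c) := by
  rw [← le_min_iff, ← le_min_iff, not_le, not_le, ← min_add_add_left, lt_min_iff]

theorem triple_step (hN : ∀ k S, ratBits (valueOracle V k S) ≤ N) (hn : 1 ≤ N) (hm : m ≤ N)
    {i : Fin n} {b : Fin m} (hi : x.i = i) (hb : x.b = b)
    (hQ : ∀ S q j, ¬ Improving V x.thr x.lock x.own i b → Q { x with S := S, q := q, j := j })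
    (hQ' : ∀ S q j, Improving V x.thr x.lock x.own i b →
      Q { x with S := S, q := q, j := j, own := Function.update x.own b i, moved := 1 }) :
    Triple V N (Rep N) Algo.step x Q := by
  refine Triple.seq (triple_fill hm i (fun s S j hs => hs.eval_agent.trans hi) ?_)
  refine Triple.seq (triple_ask hN i (fun s hs => hs.eval_agent.trans hi) ?_)
  refine Triple.seq (Triple.setIdx rep_bounded
    { x with
      S := insert b (bundle x.own i)
      q := Function.update x.q 0 (V i (bundle x.own i))
      j := m } (fun s hs => ?_) ?_)
  · rw [hs.eval_item.trans hb]
    exact hs.set_S_one b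
  refine Triple.seq (triple_ask hN i (fun s hs => hs.eval_agent.trans hi) ?_)
  have howner : ∀ s S q j, Rep N s { x with S := S, q := q, j := j } →
      (IdxExpr.load 1 Algo.item).eval s = x.own b := fun s S q j hs => by
    simp only [IdxExpr.eval, hs.eval_item, hb, hs.own b b.2]
  refine Triple.seq (triple_fill hm (x.own b) (fun s S j hs => howner s _ _ _ hs) ?_)
  refine Triple.seq (triple_ask hN (x.own b) (fun s hs => howner s _ _ _ hs) ?_)
  refine Triple.seq (Triple.setIdx rep_bounded
    { x with
      S := (bundle x.own (x.own b)).erase b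
      q := Function.update (Function.update (Function.update x.q 0 (V i (bundle x.own i)))
        1 (V i (insert b (bundle x.own i)))) 2 (V (x.own b) (bundle x.own (x.own b)))
      j := m } (fun s hs => ?_) ?_)
  · rw [hs.eval_item.trans hb]
    exact hs.set_S_zero b
  refine Triple.seq (triple_ask hN (x.own b) (fun s hs => howner s _ _ _ hs) ?_)
  refine Triple.ite rep_bounded (Improving V x.thr x.lock x.own i b) (fun s hs => ?_)
    (fun h => ?_) (fun h => Triple.skip (hQ _ _ _ h))
  · have h₁ : Algo.agent.eval s = i := hs.eval_agent.trans hi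
    have h₂ : Algo.item.eval s = b := hs.eval_item.trans hb
    have h₃ := hs.eval_thr h₁
    have h₄ := hs.eval_thr (howner s _ _ _ hs)
    have h₅ : Improving V x.thr x.lock x.own i b ↔ (b ∉ x.lock ∧ 3 * V i (bundle x.own i) < x.thr i) ∧
        capped V x.thr (x.own b) (bundle x.own (x.own b)) <
          V i (insert b (bundle x.own i)) / x.thr i - V i (bundle x.own i) / x.thr i -
            1 / (3 * m) + capped V x.thr (x.own b) ((bundle x.own (x.own b)).erase b) :=
      ⟨fun h => ⟨⟨h.1, h.2⟩, h.3⟩, fun h => ⟨h.1.1, h.1.2, h.2⟩⟩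
    rw [h₅, capped, capped, min_lt_add_min_iff]
    have h₆ := hs.lock b b.2
    simp only [Algo.improving, Test.Holds, ValExpr.eval, h₃, h₄, hs.eval_answer]
    simp only [IdxExpr.eval, h₂, Nat.le_zero, h₆, Algo.nItems, hs.items]
    simp [Vars.thr]
  · refine Triple.seq (Triple.setIdx rep_bounded
      { x with
        S := (bundle x.own (x.own b)).erase b
        q := Function.update (Function.update (Function.update (Function.update x.q 0
          (V i (bundle x.own i))) 1 (V i (insert b (bundle x.own i)))) 2
          (V (x.own b) (bundle x.own (x.own b)))) 3 (V (x.own b) ((bundle x.own (x.own b)).erase b))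
        j := m
        own := Function.update x.own b i } (fun s hs => ?_) ?_)
    · rw [hs.eval_item.trans hb, hs.eval_agent.trans hi]
      exact hs.set_own b i
    · exact Triple.setIdx rep_bounded _ (fun s hs => hs.set_moved hn) (hQ' _ _ _ h)

theorem triple_search [NeZero n] (hV : ∀ i, IsSubmodularValuation (V i))
    (hN : ∀ k S, ratBits (valueOracle V k S) ≤ N) (hn : n ≤ N) (hm : m ≤ N)
    (hnm : 3 * n * m + 1 ≤ N) (hT : ∀ i, 0 ≤ x.thr i)
    (hsmall : ∀ i b, 0 < x.thr i → b ∉ x.lock → 3 * V i {b} < x.thr i)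
    (hQ : ∀ y : Vars n m, y.v = x.v → y.k = x.k → y.kk = x.kk → y.lock = x.lock → y.fin = x.fin →
      (∀ b ∈ x.lock, y.own b = x.own b) → (∀ i b, ¬ Improving V x.thr x.lock y.own i b) → Q y) :
    Triple V N (Rep N) Algo.search x Q := by
  let Frame : Vars n m → Prop := fun y => y.v = x.v ∧ y.k = x.k ∧ y.kk = x.kk ∧
    y.lock = x.lock ∧ y.fin = x.fin ∧ ∀ b ∈ x.lock, y.own b = x.own b
  have hframe_thr : ∀ y, Frame y → y.thr = x.thr := by
    rintro y ⟨hv, -, hkk, -⟩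
    funext i
    rw [Vars.thr, Vars.thr, hv, hkk]
  have hN1 : 1 ≤ N := (Nat.le_add_left 1 _).trans hnm
  let ε : ℚ := 1 / (3 * m)
  refine Triple.seq (Triple.setIdx rep_bounded { x with moved := 1 }
    (fun s hs => hs.set_moved hN1) ?_)
  -- While the flag is set, the `r` remaining passes, each worth `ε`, would suffice to lift the
  -- potential to `n`. The extra pass in `3 * n * m + 1` also covers `m = 0`, where `ε = 0` and the
  -- potential says nothing.
  refine Triple.loop rep_bounded (fun y => y.moved ≠ 0) (fun r y => Frame y ∧
    (y.moved = 0 → ∀ i b, ¬ Improving V x.thr x.lock y.own i b) ∧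
    (y.moved ≠ 0 → 1 ≤ r ∧ (0 < m → n ≤ potential V x.thr y.own + r * ε))) (j := 3 * n * m + 1)
    hnm ?_ ?_ ?_ ?_
  · refine ⟨⟨rfl, rfl, rfl, rfl, rfl, fun _ _ => rfl⟩, by simp, fun _ => ⟨by omega, fun hm0 => ?_⟩⟩
    have h := potential_nonneg (own := x.own) hV hT
    have hm' : (0 : ℚ) < m := by exact_mod_cast hm0
    have hε : 0 < ε := by positivity
    have h' : ((3 * n * m + 1 : ℕ) : ℚ) * ε = n + ε := by
      simp only [ε]
      push_cast
      field_simp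
    rw [h']
    linarith
  · intro s j y _ hs
    simp [Test.Holds, IdxExpr.eval, hs.moved, Nat.one_le_iff_ne_zero]
  · rintro r y ⟨hF, -, hr⟩ hmoved
    obtain ⟨hr1, hpot⟩ := hr hmoved
    refine ⟨r - 1, by omega, ?_⟩
    refine Triple.seq (Triple.setIdx rep_bounded { y with moved := 0 }
      (fun s hs => hs.set_moved (Nat.zero_le _)) ?_)
    -- Until the first move of a pass the owners are unchanged, so rejected pairs stay rejected and
    -- a pass without moves certifies stability. After a move the potential has risen by more than
    -- `ε`.
    let Inv : (Fin n → Fin m → Prop) → Vars n m → Prop := fun D z => Frame z ∧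
      (z.moved = 0 → z.own = y.own ∧ ∀ i b, D i b → ¬ Improving V x.thr x.lock z.own i b) ∧
      (z.moved ≠ 0 → 0 < m ∧ potential V x.thr y.own + ε < potential V x.thr z.own)
    refine triple_forAgents hn (fun i z => Inv (fun i' _ => (i' : ℕ) < i) z)
      ⟨hF, by simp, by simp⟩ ?_ ?_
    · rintro i z hzi hz
      refine triple_forItems hm (fun b z => z.i = i ∧
        Inv (fun i' b' => (i' : ℕ) < i ∨ i' = i ∧ (b' : ℕ) < b) z)
        ⟨hzi, by simpa [Inv, Frame] using hz⟩ ?_ ?_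
      · rintro b w hwb ⟨hwi, hwF, hw0, hw1⟩
        have hthr := hframe_thr w hwF
        obtain ⟨hv, hk, hkk, hlock, hfin, hown⟩ := hwF
        refine triple_step hN hN1 hm hwi hwb (fun S q j hnot => ?_) fun S q j himp => ?_
        · rw [hthr, hlock] at hnot
          refine ⟨hwb, hwi, ⟨hv, hk, hkk, hlock, hfin, hown⟩, fun h0 => ⟨(hw0 h0).1,
            fun i' b' hD => ?_⟩, hw1⟩
          by_cases h : i' = i ∧ b' = b
          · rw [h.1, h.2]
            exact hnot
          · refine (hw0 h0).2 i' b' (hD.imp_right fun h' => ⟨h'.1, ?_⟩)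
            have := fun e => h ⟨h'.1, Fin.ext e⟩
            have := h'.2
            omega
        · rw [hthr, hlock] at himp
          refine ⟨hwb, hwi, ⟨hv, hk, hkk, hlock, hfin, fun c hc => ?_⟩, by simp, fun _ => ?_⟩
          · have hcb : c ≠ b := fun h => himp.notMem (h ▸ hc)
            simpa [hcb] using hown c hc
          · have h := himp.potential_add_lt hV hT hsmall
            have hm0 : 0 < m := Nat.zero_lt_of_lt b.2
            have hε : 0 ≤ ε := by positivity
            refine ⟨hm0, lt_of_le_of_lt ?_ h⟩
            by_cases h0 : w.moved = 0
            · rw [(hw0 h0).1]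
            · have := (hw1 h0).2
              linarith
      · rintro w ⟨hwi, hwF, hw0, hw1⟩
        refine ⟨hwi, hwF, fun h0 => ⟨(hw0 h0).1, fun i' b' hD => (hw0 h0).2 i' b' ?_⟩, hw1⟩
        by_cases h : i' = i
        · exact Or.inr ⟨h, b'.2⟩
        · have := fun h' => h (Fin.ext h')
          exact Or.inl (by omega)
    · rintro z ⟨hzF, hz0, hz1⟩
      refine ⟨hzF, fun h0 i b => (hz0 h0).2 i b i.2, fun h1 => ?_⟩
      obtain ⟨hm0, hlt⟩ := hz1 h1
      have hcast : ((r - 1 : ℕ) : ℚ) = r - 1 := by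
        rw [Nat.cast_sub hr1, Nat.cast_one]
      have hp := hpot hm0
      have hnew : (n : ℚ) ≤ potential V x.thr z.own + ((r - 1 : ℕ) : ℚ) * ε := by
        rw [hcast]
        linarith
      refine ⟨?_, fun _ => hnew⟩
      by_contra hr0
      have h0 : r - 1 = 0 := by omega
      rw [h0, Nat.cast_zero, zero_mul, add_zero] at hnew
      exact absurd potential_lt (not_lt.mpr hnew)
  · rintro r y ⟨⟨hv, hk, hkk, hlock, hfin, hown⟩, hstable, -⟩ hmoved
    exact hQ y hv hk hkk hlock hfin hown (hstable (not_not.mp hmoved))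

/-! ### End of a round -/

/-- The factors lowered are `k`, while the tests read `kk`, so the thresholds of the round stay
fixed during the pass. Agents served with a single item have `kk = 0` and are never lowered. -/
theorem triple_update (hN : ∀ k S, ratBits (valueOracle V k S) ≤ N) (hn : n ≤ N) (hm : m ≤ N)
    (hfin : x.fin = 1)
    (hQ : ∀ y : Vars n m, y.v = x.v → y.own = x.own →
      (∀ i, y.k i = if 3 * V i (bundle x.own i) < x.thr i then x.k i - 1 else x.k i) →
      (y.fin = 0 ↔ ∃ i, 3 * V i (bundle x.own i) < x.thr i) → Q y) :
    Triple V N (Rep N) Algo.update x Q := by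
  refine triple_forAgents hn (fun i y => y.v = x.v ∧ y.own = x.own ∧ y.kk = x.kk ∧
    (∀ i' : Fin n, y.k i' = if (i' : ℕ) < i ∧ 3 * V i' (bundle x.own i') < x.thr i'
      then x.k i' - 1 else x.k i') ∧
    (y.fin = 0 ↔ ∃ i' : Fin n, (i' : ℕ) < i ∧ 3 * V i' (bundle x.own i') < x.thr i'))
    ⟨rfl, rfl, rfl, by simp, by simp [hfin]⟩ ?_ ?_
  · rintro i y hyi ⟨hv, hown, hkk, hk, hf⟩
    have hthr : y.thr i = x.thr i := by rw [Vars.thr, Vars.thr, hv, hkk]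
    refine Triple.seq (triple_fill hm i (fun s S j hs => hs.eval_agent.trans hyi) ?_)
    refine Triple.seq (triple_ask hN i (fun s hs => hs.eval_agent.trans hyi) ?_)
    refine Triple.ite rep_bounded (3 * V i (bundle x.own i) < x.thr i) (fun s hs => ?_)
      (fun h => ?_) (fun h => ?_)
    · have h₁ := hs.eval_thr (hs.eval_agent.trans hyi)
      simp only [Test.Holds, ValExpr.eval, h₁, hs.eval_answer, Function.update_self, not_le, hown]
      rw [← hthr]
      rfl
    · refine Triple.seq (Triple.setIdx rep_bounded
        { y with
          S := bundle y.own i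
          q := Function.update y.q 0 (V i (bundle y.own i))
          j := m
          k := Function.update y.k i (y.k i - 1) } (fun s hs => ?_) ?_)
      · have h := hs.set_k i ((Nat.sub_le _ 1).trans (hs.k_le i))
        rw [hs.eval_agent.trans hyi]
        simpa [IdxExpr.eval, hs.eval_agent.trans hyi, hs.k i i.2] using h
      · refine Triple.setIdx rep_bounded _ (fun s hs => hs.set_fin (Nat.zero_le _))
          ⟨hyi, hv, hown, hkk, fun i' => ?_, ?_⟩
        · by_cases hi' : i' = i
          · subst hi'
            simp [hk, h]
          · have hlt : (i' : ℕ) < i + 1 ↔ (i' : ℕ) < i := by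
              have := fun h' => hi' (Fin.ext h')
              omega
            simp only [hlt, Function.update_of_ne hi', hk i']
        · simp only [true_iff]
          exact ⟨i, Nat.lt_succ_self _, h⟩
    · refine Triple.skip ⟨hyi, hv, hown, hkk, fun i' => ?_, ?_⟩
      · by_cases hi' : i' = i
        · subst hi'
          simp [hk, h]
        · have hlt : (i' : ℕ) < i + 1 ↔ (i' : ℕ) < i := by
            have := fun h' => hi' (Fin.ext h')
            omega
          simp only [hlt, hk i']
      · simp only [hf]
        refine exists_congr fun i' => and_congr_left fun h' => ?_
        have hne : (i' : ℕ) ≠ i := fun e => by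
          obtain rfl := Fin.ext e
          exact h h'
        omega
  · rintro y ⟨hv, hown, -, hk, hf⟩
    exact hQ y hv hown (fun i => by simpa using hk i) (by simpa using hf)

/-! ### The whole program -/

theorem threshold_nonneg {v : ℚ} (hv : 0 ≤ v) (k : ℕ) : 0 ≤ threshold n v k := by
  unfold threshold
  positivity

/-- Lowering the factor of a threshold that is too large by one does not make it too small. -/
theorem le_threshold_pred [NeZero n] {μ v : ℚ} {k : ℕ} (hv : 0 ≤ v) (hvμ : v ≤ μ)
    (hμ : μ < threshold n v k * (1 - 1 / (3 * n))) : μ ≤ threshold n v (k - 1) := by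
  have hn : (1 : ℚ) ≤ n := by exact_mod_cast Nat.pos_of_neZero n
  have hn3 : (0 : ℚ) < 3 * n := by linarith
  have hpos : 0 ≤ 1 / (3 * n : ℚ) := by positivity
  have ht := threshold_nonneg (n := n) hv k
  have hμt : μ ≤ threshold n v k := by nlinarith
  -- For `k = 0` the hypothesis would give `μ < 0 ≤ v ≤ μ`. Thus the truncated `k - 1` is a true
  -- predecessor.
  have hk : 1 ≤ k := by
    by_contra h
    obtain rfl : k = 0 := by omega
    simp only [threshold, Nat.cast_zero, mul_zero, zero_div, zero_mul] at hμ
    linarith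
  have h : threshold n v (k - 1) = threshold n v k - v * (1 / (3 * n)) := by
    rw [threshold, threshold, Nat.cast_sub hk]
    push_cast
    ring
  rw [h]
  nlinarith [mul_le_mul_of_nonneg_right (hvμ.trans hμt) hpos]

theorem triple_main [NeZero n] (hV : ∀ i, IsSubmodularValuation (V i))
    (hN : ∀ k S, ratBits (valueOracle V k S) ≤ N) (hn : n ≤ N) (hm : m ≤ N)
    (hnm : 3 * n * m + 1 ≤ N) (hk : 3 * n * (m + 1) ≤ N) (hnk : n * (3 * n * (m + 1)) + 1 ≤ N)
    (hS : x.S = ∅) (hfin : x.fin = 0)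
    (hQ : ∀ y : Vars n m, (∀ i, mms n (V i) ≤ 3 * V i (bundle y.own i)) → Q y) :
    Triple V N (Rep N) Algo.main x Q := by
  refine Triple.seq (triple_init hN hn hm hk hS fun x hxfin hv hxk => ?_)
  -- Thresholds never fall below the maxmin values, and the sum of the factors, initially `n * (3 *
  -- n * (m + 1))`, bounds the number of failed rounds.
  refine Triple.loop rep_bounded (fun y => y.fin = 0) (fun r y =>
    (∀ i, IsNthValue n (V i) (y.v i)) ∧
    (∀ i, mms n (V i) ≤ threshold n (y.v i) (y.k i)) ∧
    (y.fin = 0 → ∑ i, y.k i < r) ∧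
    (y.fin ≠ 0 → ∀ i, mms n (V i) ≤ 3 * V i (bundle y.own i))) hnk ?_ ?_ ?_ ?_
  · refine ⟨hv, fun i => ((hv i).mms_le (hV i)).trans_eq ?_, fun _ => by simp [hxk],
      fun h => absurd (hxfin.trans hfin) h⟩
    have hn0 : ((3 * n : ℕ) : ℚ) ≠ 0 := by
      have := Nat.pos_of_neZero n
      exact_mod_cast (by omega : 3 * n ≠ 0)
    rw [threshold, hxk, Nat.cast_mul (3 * n), mul_left_comm, mul_div_cancel_left₀ _ hn0]
    push_cast
    rfl
  · intro s j y _ hs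
    simp [Test.Holds, IdxExpr.eval, hs.fin]
  · rintro r y ⟨hv, hmms, hr, -⟩ hfin
    have hr := hr hfin
    refine ⟨r - 1, by omega, ?_⟩
    have hv0 : ∀ i, 0 ≤ y.v i := fun i => ((hV i).nonneg ∅).trans (hv i).empty_le
    refine Triple.seq (triple_reset hn hm fun y₁ hv₁ hk₁ hkk₁ hlock₁ hS₁ hfin₁ => ?_)
    refine Triple.seq (triple_lockPass hN hn hm (hkk₁.trans hk₁.symm) hlock₁ hS₁
      fun y₂ hv₂ hk₂ hfin₂ hserved hcard hsmall => ?_)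
    have hv' : y₂.v = y.v := hv₂.trans hv₁
    have hk' : y₂.k = y.k := hk₂.trans hk₁
    have hT : ∀ i, 0 ≤ y₂.thr i := fun i => threshold_nonneg (hv' ▸ hv0 i) _
    have hkk : ∀ i, 0 < y₂.thr i → y₂.kk i ≠ 0 := by
      intro i hi h0
      simp [Vars.thr, threshold, h0] at hi
    refine Triple.seq (triple_search hV hN hn hm hnm hT
      (fun i b hi hb => hsmall i b (hkk i hi) hb)
      fun y₃ hv₃ hk₃ hkk₃ hlock₃ hfin₃ hown₃ hstable => ?_)
    have hthr₃ : y₃.thr = y₂.thr := by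
      funext i
      rw [Vars.thr, Vars.thr, hv₃, hkk₃]
    refine triple_update hN hn hm (hfin₃.trans (hfin₂.trans hfin₁)) fun y₄ hv₄ hown₄ hk₄ hfin₄ => ?_
    rw [hthr₃] at hfin₄
    simp only [hthr₃, hk₃.trans hk'] at hk₄
    have hv₄' : y₄.v = y.v := hv₄.trans (hv₃.trans hv')
    -- An unsatisfied agent has a positive threshold, hence was not served and competes with its
    -- full threshold. Positive thresholds need `kk ≠ 0`, so the cardinalities from the locking pass
    -- give the hypothesis of `mms_lt_of_stable`.
    have hlow : ∀ i, 3 * V i (bundle y₃.own i) < y₂.thr i →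
        y₂.thr i = threshold n (y.v i) (y.k i) ∧
          mms n (V i) < threshold n (y.v i) (y.k i) * (1 - 1 / (3 * n)) := by
      intro i hi
      have hpos : 0 < y₂.thr i :=
        lt_of_le_of_lt (by linarith [(hV i).nonneg (bundle y₃.own i)]) hi
      have heq : y₂.thr i = threshold n (y.v i) (y.k i) := by
        rw [Vars.thr, hv', (hserved i).resolve_right fun h => hkk i hpos h.1, hk']
      refine ⟨heq, heq ▸ mms_lt_of_stable hV hT ?_ (hstable i) hi⟩
      have h₁ : (Finset.univ.filter fun k => 0 < y₂.thr k).card ≤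
          (Finset.univ.filter fun k => ¬ y₂.kk k = 0).card :=
        Finset.card_le_card fun k hk => by simpa using hkk k (by simpa using hk)
      have h₂ := Finset.card_filter_add_card_filter_not (s := (Finset.univ : Finset (Fin n)))
        (fun k => y₂.kk k = 0)
      rw [Finset.card_univ, Fintype.card_fin] at h₂
      omega
    refine ⟨fun i => hv₄' ▸ hv i, fun i => ?_, fun h => ?_, fun h i => ?_⟩
    · rw [hv₄', hk₄]
      split_ifs with hi
      · exact le_threshold_pred (hv0 i) ((hv i).le_mms (hV i)) (hlow i hi).2
      · exact hmms i
    · obtain ⟨i, hi⟩ := hfin₄.mp h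
      have hki : y.k i ≠ 0 := by
        intro h0
        have h₁ := hlow i hi
        have h₂ := (hV i).nonneg (bundle y₃.own i)
        rw [h₁.1, h0, threshold, Nat.cast_zero, mul_zero, zero_div] at hi
        linarith
      have hlt : ∑ i, y₄.k i < ∑ i, y.k i := by
        refine Finset.sum_lt_sum (fun i' _ => ?_) ⟨i, Finset.mem_univ i, ?_⟩
        · rw [hk₄]
          split_ifs
          exacts [Nat.sub_le _ _, le_rfl]
        · rw [hk₄, if_pos hi]
          omega
      omega
    · have hsat : y₂.thr i ≤ 3 * V i (bundle y₃.own i) :=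
        not_lt.mp fun hi => h (hfin₄.mpr ⟨i, hi⟩)
      rw [hown₄]
      refine (hmms i).trans ?_
      -- A served agent trivially meets its current threshold `0`; its guarantee comes from its
      -- locked item, which the search has not moved.
      rcases hserved i with hi | ⟨-, b, hb, hown, hle⟩
      · rwa [Vars.thr, hi, hv', hk'] at hsat
      · rw [hv', hk'] at hle
        have hbi : {b} ⊆ bundle y₃.own i := by
          rw [Finset.singleton_subset_iff, mem_bundle, hown₃ b hb, hown]
        linarith [(hV i).mono hbi]
  · rintro r y ⟨-, -, -, hdone⟩ hfin
    exact hQ y (hdone hfin)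

/-! ### Input, output and the size of oracle answers -/

theorem rep_inputMemory [NeZero n] (hn : n ≤ N) (hm : m ≤ N) (hN : 1 ≤ N) :
    Rep N (inputMemory n m)
      ({ v := 0, q := 0, k := 0, kk := 0, own := fun _ => 0, lock := ∅, S := ∅, i := 0, b := 0,
         j := 0, cnt := 0, moved := 0, fin := 0 } : Vars n m) where
  bounded :=
    { idx_le := fun a k => by
        simp only [inputMemory]
        split_ifs <;> omega
      val_le := fun a k => by simpa [inputMemory, ratBits] using hN }
  agents := by simp [inputMemory]
  items := by simp [inputMemory]
  v := by simp [inputMemory]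
  q := by simp [inputMemory]
  k := by simp [inputMemory]
  kk := by simp [inputMemory]
  own := by simp [inputMemory]
  lock := by simp [inputMemory]
  S := by simp [inputMemory]
  i := by simp [inputMemory]
  b := by simp [inputMemory]
  j := by simp [inputMemory]
  cnt := by simp [inputMemory]
  moved := by simp [inputMemory]
  fin := by simp [inputMemory]

theorem Rep.outputBundles_eq {s : Memory} (h : Rep N s x) :
    outputBundles n m s = bundle x.own := by
  funext i
  ext b
  simp [outputBundles, bundle, h.own b b.2, Fin.ext_iff]

theorem ratBits_valueOracle_le {B : ℕ} (hV : ∀ i S, ratBits (V i S) ≤ B) (k : ℕ)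
    (S : Finset (Fin m)) : ratBits (valueOracle V k S) ≤ B + 1 := by
  unfold valueOracle
  split_ifs with h
  · exact (hV _ S).trans (Nat.le_succ B)
  · simp [ratBits]

end FairAllocation

/-! ### The polynomial time bound -/

theorem mainTheorem4 :
    ∃ (P : FairAllocation.Program) (p : Polynomial ℕ),
      ∀ (n m B : ℕ) [NeZero n] (V : Fin n → Finset (Fin m) → ℚ),
        (∀ i, FairAllocation.IsSubmodularValuation (V i)) →
        (∀ i S, FairAllocation.ratBits (V i S) ≤ B) →
        ∃ (c : ℕ) (s : FairAllocation.Memory),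
          FairAllocation.Runs V P (FairAllocation.inputMemory n m) c s ∧
          c ≤ p.eval (n + m + B) ∧
          FairAllocation.IsMMSAllocation (1 / 3) V (FairAllocation.outputBundles n m s) := by
  refine ⟨FairAllocation.Algo.main,
    FairAllocation.Algo.main.costBound.comp (3 * (Polynomial.X + 1) ^ 3), ?_⟩
  intro n m B _ V hV hB
  obtain ⟨M, hM⟩ : ∃ M, M = n + m + B := ⟨_, rfl⟩
  -- A single bound above everything needed: the oracle answers with at most `B + 1` bits, the
  -- initial factors, and the iteration counts, the largest being `n * (3 * n * (m + 1)) + 1 ≤ 3 * M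
  -- ^ 3 + 3 * M ^ 2 + 1`.
  obtain ⟨N, hN⟩ : ∃ N, N = 3 * (M + 1) ^ 3 := ⟨_, rfl⟩
  have hnM : n ≤ M := by omega
  have hmM : m ≤ M := by omega
  have hMN : M + 1 ≤ N := by
    rw [hN]
    nlinarith [Nat.zero_le M, Nat.zero_le (M ^ 2), Nat.zero_le (M ^ 3)]
  have hk : 3 * n * (m + 1) ≤ 3 * M * (M + 1) := by gcongr
  have hnm : 3 * n * m ≤ 3 * M * M := by gcongr
  have hnk : n * (3 * n * (m + 1)) ≤ M * (3 * M * (M + 1)) := by gcongr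
  have htriple := FairAllocation.triple_main (N := N) hV
    (fun k S => (FairAllocation.ratBits_valueOracle_le hB k S).trans (by omega))
    (by omega) (by omega)
    (hN ▸ by nlinarith [Nat.zero_le M, Nat.zero_le (M ^ 2), Nat.zero_le (M ^ 3)])
    (hN ▸ by nlinarith [Nat.zero_le M, Nat.zero_le (M ^ 2), Nat.zero_le (M ^ 3)])
    (hN ▸ by nlinarith [Nat.zero_le M, Nat.zero_le (M ^ 2), Nat.zero_le (M ^ 3)])
    rfl rfl (fun _ hy => hy) (FairAllocation.inputMemory n m)
    (FairAllocation.rep_inputMemory (by omega) (by omega) (by omega))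
  obtain ⟨c, s, hrun, hc, y, hy, hmms⟩ := htriple
  refine ⟨c, s, hrun, ?_, ?_⟩
  · rw [← hM]
    simpa [Polynomial.eval_comp, ← hN] using hc
  · rw [hy.outputBundles_eq]
    exact ⟨FairAllocation.isAllocation_fibers y.own, fun i => by linarith [hmms i]⟩
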